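/- **Setting.** We consider the parallel-leader BFT protocol Fast'n'Fair-BFT with $n=3f+1$ replicas, at most $f$ of them byzantine (behaving arbitrarily), after the global stabilization time (GST): messages between correct replicas take at most $\Delta$. Time is measured in units in which a correct replica computes or verifies one authenticator (signature). *Epochs.* The protocol proceeds in epochs, each initiated by a primary; in an epoch every replica $v$ is also the leader of its own sequence of at most $C_v(e)$ assigned requests. For one request the leader processes $4f+3$ authenticators and every other replica $5$ (pre-prepare, prepare, prepared-certificate, commit, commit-certificate; certificates are $(2f+1,n)$ threshold signatures). After every $k$ requests of a leader a checkpoint is created, which costs the leader $2f+2$ and every other replica $2$ authenticators; a replica accepts requests of a leader only up to $2k$ beyond the last stable checkpoint of that leader known to it. A request is committed if at least $f+1$ correct replicas have delivered it. Let $c_v(e)$ be the number of requests of leader $v$ committed in epoch $e$. Then $C_v(0)=C_{\min}$, and $C_v(e+1)=\max(C_{\min},\max_{0\le i\le f}c_v(e-i))$ if $c_v(e)<C_v(e)$, and $C_v(e+1)=2c_v(e)$ otherwise. *Leaving an epoch.* A correct replica leaves an epoch when it has delivered all assigned requests, when its epoch timer $T$ has expired, when its no-progress timers ($T_p$, first set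 $5\Delta$ after entering) have expired for $2f+1$ leaders, when it did not get into the epoch before its epoch-change timer expired ($T_e$ by default, doubled with every further unsuccessful epoch-change after $f$ consecutive ones), or when $f+1$ other replicas have called for leaving. A correct primary completes the epoch-change for all correct replicas within the time $\Theta(n^2)$ needed to process the authenticators of the epoch-change messages, the 3-phase reliable broadcast and the new-epoch message, plus five message delays. *Primaries.* First all replicas are primary once, in the order of their identifiers. Afterwards a replica whose last turn as primary was exactly $g$ epochs ago is primary again; otherwise the next one of the current $2f+1$ best primaries is elected, the one not seen for the longest time first. The $2f+1$ best are redetermined each time they have all had their turn, according to the number of requests committed in the epoch of their last turn. *Parameters.* $k\ge 1$ and $\Delta$ are constants; the others may depend on $f$: $g\ge 3f+1$; $C_{\min}\in\Omega(n^2)$; $T$ is at least $C_{\min}$ times the time $\frac{k(19f+3)+(8f+2)}{k}$ for one request of each of the $n$ leaders; $T_e\in O(n^2)$ is at least the duration of an epoch-change under a correct primary plus $\Delta$; $T_p$ is arbitrary. *Stable state.* We consider runs that eventually (from some epoch on, after GST) are in the stable state: message delays are at most $\Delta$, and in each epoch with a correct primary (i) throughput is limited by computing power only, i.e. while all correct replicas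 are in the epoch (and entered it at least $5\Delta$ ago), a correct replica that still has assigned requests of its own to commit is never idle; (ii) the no-progress timer does not expire for correct leaders that still have requests to commit; (iii) correct leaders work at their capacity: their assigned requests keep them occupied for the epoch time $T$, up to $o(T)$. Nothing is assumed about epochs with a byzantine primary beyond the rules above. *Utilization.* The worst-case throughput is the infimum, over all such runs with at most $f$ byzantine replicas, of the lower long-run number of committed requests per time unit ($\liminf$ over the ends of the epochs). The best-case throughput is the supremum of the upper long-run number ($\limsup$), over all such runs without byzantine replicas in which every replica processes all requests and checkpoints of all leaders, lagging behind by at most one checkpoint. The effective utilization is the quotient of the worst-case and the best-case throughput. **Theorem (byzantine-resilient performance).** After GST, the effective utilization is asymptotically at least $\frac{8}{9}\cdot\frac{g-f}{g}$: for all sufficiently large $n=3f+1$, $$\text{effective utilization}\;\ge\;\frac{8}{9}\cdot\frac{g-f}{g},$$ and $\frac{8}{9}\cdot\frac{g-f}{g}>\frac{16}{27}$ for every $f$. -/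

import Mathlib

open Filter Asymptotics
open scoped ENNReal

namespace FnF

/-- Parameters of the protocol: fault bound `f`, checkpoint interval `k`, message delay bound `Δ`
after GST, sliding window length `g`, minimum load `Cmin`, epoch timer `T`, default epoch-change
timer `Te`, no-progress timer `Tp`, and the tolerance `δ` (in time units) up to which the load of a
leader matches its capacity in the stable state. -/
structure Params where
  f : ℕ
  k : ℕ
  Δ : ℕ
  g : ℕ
  Cmin : ℕ
  T : ℕ
  Te : ℕ
  Tp : ℕ
  δ : ℕ

/-- What a replica spends authenticators on during an epoch: `request v i` is the request with local
sequence number `i` (counted from `0`) of leader `v`; `checkpoint v m` is the `m`-th checkpoint of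
leader `v`, taken after its first `k * m` requests. -/
inductive Task (n : ℕ) where
  | request (v : Fin n) (i : ℕ) : Task n
  | checkpoint (v : Fin n) (m : ℕ) : Task n

namespace Params

variable (P : Params)

/-- Number of replicas. -/
def n : ℕ := 3 * P.f + 1

/-- Authenticators a replica computes or verifies for one request. The leader signs the pre-prepare
message, verifies `2f` prepare messages and combines them, verifies `2f` commit messages and
combines them. A backup verifies the pre-prepare and signs a prepare message, verifies the
prepared-certificate and signs a commit message, and verifies the commit-certificate. -/
def leaderRequestCost : ℕ := 1 + (2 * P.f + 1) + (2 * P.f + 1)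

def backupRequestCost : ℕ := 2 + 2 + 1

/-- Authenticators for one checkpoint. The leader verifies `2f` signatures, signs, and combines; a
backup signs and verifies the checkpoint-certificate. -/
def leaderCheckpointCost : ℕ := 2 * P.f + 1 + 1

def backupCheckpointCost : ℕ := 1 + 1

/-- Authenticators replica `u` has to process for a task. -/
def cost (u : Fin P.n) : Task P.n → ℕ
  | .request v _ => if u = v then P.leaderRequestCost else backupRequestCost
  | .checkpoint v _ => if u = v then P.leaderCheckpointCost else backupCheckpointCost

/-- Time units a replica needs for `k` requests and one checkpoint of each of the `n` leaders. -/
def intervalCost : ℕ :=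
  P.k * (P.leaderRequestCost + 3 * P.f * backupRequestCost)
    + (P.leaderCheckpointCost + 3 * P.f * backupCheckpointCost)

/-- Authenticators a replica processes in an epoch-change led by a correct primary: its own
epoch-change message; those of the others, each holding a signature, a checkpoint-certificate per
leader and a certificate for each of at most `2k` open requests per leader; the 3-phase reliable
broadcast (one message of the primary and two all-to-all rounds); the new-epoch message with a
pre-prepare for each open request. -/
def changeCost : ℕ :=
  1 + (P.n - 1) * (1 + P.n + 2 * P.k * P.n) + (1 + 2 * (1 + 2 * P.f)) + (1 + 2 * P.k * P.n)

/-- Duration of an epoch-change led by a correct primary: one authenticator per time unit, and five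
message delays (epoch-change message, three broadcast phases, new-epoch message). -/
def changeTime : ℕ := P.changeCost + 5 * P.Δ

end Params

/-- The raw data of a run. Time is discrete, in units in which a replica computes or verifies one
authenticator. Only the entries of correct replicas are meaningful. -/
structure Run (P : Params) where
  /-- the byzantine replicas -/
  byz : Finset (Fin P.n)
  /-- the primary of each epoch -/
  primary : ℕ → Fin P.n
  /-- the primaries of the current rotation that are still to be elected -/
  queue : ℕ → List (Fin P.n)
  /-- `load e v`: number of requests assigned to leader `v` in epoch `e` -/
  load : ℕ → Fin P.n → ℕ
  /-- `start e u`: time at which `u` starts its epoch-change timer for epoch `e` -/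
  start : ℕ → Fin P.n → ℕ
  /-- `enter e u`: time at which `u` accepts the new-epoch message of epoch `e`, if it does -/
  enter : ℕ → Fin P.n → Option ℕ
  /-- `call e u`: time at which `u` leaves epoch `e` by broadcasting an epoch-change message -/
  call : ℕ → Fin P.n → ℕ
  /-- `work e u t`: the task of epoch `e` for which `u` processes an authenticator in time unit
  `t` -/
  work : ℕ → Fin P.n → ℕ → Option (Task P.n)
  /-- `low e u v t`: index of the last stable checkpoint of leader `v` in epoch `e` known to `u` at
  time `t`; the low watermark is `k` times this number -/
  low : ℕ → Fin P.n → Fin P.n → ℕ → ℕ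

namespace Run

variable {P : Params} (x : Run P)

def correct : Finset (Fin P.n) := x.byzᶜ

open Classical in
/-- Authenticators that `u` has processed for a task before time `t`. -/
noncomputable def count (e : ℕ) (u : Fin P.n) (τ : Task P.n) (t : ℕ) : ℕ :=
  ((Finset.range t).filter (fun s => x.work e u s = some τ)).card

def Done (e : ℕ) (u : Fin P.n) (τ : Task P.n) (t : ℕ) : Prop :=
  P.cost u τ ≤ x.count e u τ t

/-- Replica `u` has delivered the first `j` requests of leader `v` in epoch `e`: each of them is
committed locally or covered by a stable checkpoint known to `u`. -/
def Delivered (e : ℕ) (u v : Fin P.n) (j t : ℕ) : Prop :=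
  ∀ i < j, P.k * x.low e u v t ≤ i → x.Done e u (.request v i) t

open Classical in
/-- `2f + 1` replicas may have signed something, given which correct replicas have. -/
def Quorum (signed : Fin P.n → Prop) : Prop :=
  2 * P.f + 1 ≤ (x.correct.filter signed).card + x.byz.card

/-- A prepared-certificate for request `i` of leader `v` can exist. -/
def PreparedCert (e : ℕ) (v : Fin P.n) (i t : ℕ) : Prop :=
  x.Quorum fun w => if w = v then 1 ≤ x.count e w (.request v i) t
    else 2 ≤ x.count e w (.request v i) t

/-- A commit-certificate for request `i` of leader `v` can exist. -/
def CommitCert (e : ℕ) (v : Fin P.n) (i t : ℕ) : Prop :=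
  x.Quorum fun w => if w = v then 2 * P.f + 2 ≤ x.count e w (.request v i) t
    else 4 ≤ x.count e w (.request v i) t

/-- A checkpoint-certificate for the `m`-th checkpoint of leader `v` can exist. -/
def StableCheckpoint (e : ℕ) (v : Fin P.n) (m t : ℕ) : Prop :=
  x.Quorum fun w => x.Delivered e w v (P.k * m) t ∧ 1 ≤ x.count e w (.checkpoint v m) t

open Classical in
/-- Number of requests committed under leader `v` in epoch `e`: those delivered by at least `f + 1`
correct replicas. -/
noncomputable def committed (e : ℕ) (v : Fin P.n) : ℕ :=
  ((Finset.range (x.load e v)).filter fun i =>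
    P.f + 1 ≤ (x.correct.filter fun u => ∃ t, x.Delivered e u v (i + 1) t).card).card

/-- Number of requests committed in epoch `e`, which is also the performance of its primary. -/
noncomputable def performance (e : ℕ) : ℕ := ∑ v, x.committed e v

/-! ### Primary rotation -/

/-- The last epoch before epoch `e` in which `u` was primary (meaningful once all replicas have been
primary, that is, for `n ≤ e`). -/
def lastTurn : ℕ → Fin P.n → ℕ
  | 0, _ => 0
  | e + 1, u => if x.primary e = u then e else lastTurn e u

/-- Performance of `u` in its last turn as primary before epoch `e`. -/
noncomputable def score (e : ℕ) (u : Fin P.n) : ℕ := x.performance (x.lastTurn e u)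

/-- `q` lists `2f + 1` best primaries, the one not seen for the longest time first. -/
structure IsBest (e : ℕ) (q : List (Fin P.n)) : Prop where
  nodup : q.Nodup
  length : q.length = 2 * P.f + 1
  best : ∀ u ∈ q, ∀ w ∉ q, x.score e w ≤ x.score e u
  order : q.Pairwise fun a b => x.lastTurn e a < x.lastTurn e b

/-- Initially all primaries are explored in the order of their identifiers. Then a replica whose
last turn was `g` epochs ago is explored again; otherwise the next one of the `2f + 1` best
primaries is elected. These are redetermined whenever all of them have had their turn. -/
structure Rotation : Prop where
  initial : ∀ e, e < P.n → (x.primary e : ℕ) = e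
  explore : ∀ e, P.n ≤ e → ∀ u, x.lastTurn e u + P.g = e → x.primary e = u
  exploit : ∀ e, P.n ≤ e → (∀ u, x.lastTurn e u + P.g ≠ e) →
    (x.queue e).head? = some (x.primary e)
  queue_init : x.IsBest P.n (x.queue P.n)
  queue_next : ∀ e, P.n ≤ e → (x.queue e).erase (x.primary e) ≠ [] →
    x.queue (e + 1) = (x.queue e).erase (x.primary e)
  queue_renew : ∀ e, P.n ≤ e → (x.queue e).erase (x.primary e) = [] →
    x.IsBest (e + 1) (x.queue (e + 1))

/-! ### Configuration adjustment -/

structure LoadAdjustment : Prop where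
  initial : ∀ v, x.load 0 v = P.Cmin
  below : ∀ e v, x.committed e v < x.load e v → x.load (e + 1) v =
    max P.Cmin ((Finset.range (P.f + 1)).sup fun i => x.committed (e - i) v)
  reached : ∀ e v, ¬ x.committed e v < x.load e v → x.load (e + 1) v = 2 * x.committed e v

/-! ### Timers and epoch-changes -/

/-- Number of consecutive unsuccessful epoch-changes `u` has experienced just before the change to
epoch `e`. -/
def failures : ℕ → Fin P.n → ℕ
  | 0, _ => 0
  | e + 1, u => if x.enter e u = none then failures e u + 1 else 0

/-- Value of the epoch-change timer of `u` for epoch `e`. -/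
def timer (e : ℕ) (u : Fin P.n) : ℕ :=
  if x.failures e u < P.f then P.Te else P.Te * 2 ^ (x.failures e u - P.f + 1)

/-- The no-progress timer of `u` for leader `v`, first set `5Δ` after `u` entered the epoch at time
`a` and reset with every commit-certificate of `v`, has expired at time `t`. -/
def NoProgress (e : ℕ) (u v : Fin P.n) (a t : ℕ) : Prop :=
  a + 5 * P.Δ + P.Tp ≤ t ∧
    ∀ i, x.Done e u (.request v i) t → x.Done e u (.request v i) (t - P.Tp)

open Classical in
/-- Replica `u` has a reason of its own to leave epoch `e` at time `t`: its epoch-change timer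
expired before it entered the epoch; or it entered and has delivered all assigned requests, or its
epoch timer expired, or it sees no progress of `2f + 1` leaders. -/
def Reason (e : ℕ) (u : Fin P.n) (t : ℕ) : Prop :=
  ((∀ a, x.enter e u = some a → t < a) ∧ x.start e u + x.timer e u ≤ t) ∨
  ∃ a, x.enter e u = some a ∧ a ≤ t ∧
    ((∀ v, x.Delivered e u v (x.load e v) t) ∨ a + P.T ≤ t ∨
      2 * P.f + 1 ≤ (Finset.univ.filter fun v => x.NoProgress e u v a t).card)

open Classical in
/-- The rules for changing epochs. `own_reason`: among the `f + 1` epoch-change messages that make a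
replica follow without a reason of its own, one comes from a correct replica, so the first correct
replica to leave has a reason. -/
structure EpochChange : Prop where
  must_call : ∀ e, ∀ u ∈ x.correct, ∀ t, x.Reason e u t → x.call e u ≤ t
  own_reason : ∀ e, ∀ u ∈ x.correct, ∃ w ∈ x.correct,
    x.call e w ≤ x.call e u ∧ x.Reason e w (x.call e w)
  call_le_start : ∀ e, ∀ u ∈ x.correct, x.call e u ≤ x.start (e + 1) u
  start_quorum : ∀ e, ∀ u ∈ x.correct, x.Quorum fun w => x.call e w ≤ x.start (e + 1) u
  start_le_enter : ∀ e, ∀ u ∈ x.correct, ∀ a, x.enter e u = some a → x.start e u ≤ a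
  enter_le_call : ∀ e, ∀ u ∈ x.correct, ∀ a, x.enter e u = some a → a ≤ x.call e u

/-! ### Epoch operation -/

/-- What correct replicas process during an epoch. -/
structure Operation : Prop where
  /-- a replica takes part in an epoch from entering to leaving it -/
  within_epoch : ∀ e, ∀ u ∈ x.correct, ∀ t, x.work e u t ≠ none →
    ∃ a, x.enter e u = some a ∧ a ≤ t ∧ t < x.call e u
  /-- only the authenticators of relevant messages are processed -/
  count_le : ∀ e, ∀ u ∈ x.correct, ∀ τ t, x.count e u τ t ≤ P.cost u τ
  /-- requests are assigned to their leader and lie between its watermarks -/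
  watermarks : ∀ e, ∀ u ∈ x.correct, ∀ t v i, x.work e u t = some (.request v i) →
    i < x.load e v ∧ P.k * x.low e u v t ≤ i ∧ i < P.k * x.low e u v t + 2 * P.k
  checkpoints : ∀ e, ∀ u ∈ x.correct, ∀ t v m, x.work e u t = some (.checkpoint v m) →
    1 ≤ m ∧ P.k * m ≤ x.load e v ∧
      (x.Delivered e u v (P.k * m) t ∨ x.StableCheckpoint e v m t)
  low_mono : ∀ e, ∀ u ∈ x.correct, ∀ v, Monotone (x.low e u v)
  low_stable : ∀ e, ∀ u ∈ x.correct, ∀ v t, 0 < x.low e u v t →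
    (∃ s < t, x.StableCheckpoint e v (x.low e u v t) s) ∧
      1 ≤ x.count e u (.checkpoint v (x.low e u v t)) t
  /-- a backup verifies what a correct leader has sent, and certificates that exist -/
  preprepare : ∀ e, ∀ u ∈ x.correct, ∀ v ∈ x.correct, ∀ i t, u ≠ v →
    1 ≤ x.count e u (.request v i) t → 1 ≤ x.count e v (.request v i) t
  leader_prepared : ∀ e, ∀ v ∈ x.correct, ∀ i t,
    2 * P.f + 2 ≤ x.count e v (.request v i) t → x.PreparedCert e v i t
  backup_prepared : ∀ e, ∀ u ∈ x.correct, ∀ v i t, u ≠ v →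
    3 ≤ x.count e u (.request v i) t → x.PreparedCert e v i t ∧
      (v ∈ x.correct → 2 * P.f + 2 ≤ x.count e v (.request v i) t)
  leader_commit : ∀ e, ∀ v ∈ x.correct, ∀ i t,
    4 * P.f + 3 ≤ x.count e v (.request v i) t → x.CommitCert e v i t
  backup_commit : ∀ e, ∀ u ∈ x.correct, ∀ v i t, u ≠ v →
    5 ≤ x.count e u (.request v i) t → x.CommitCert e v i t ∧
      (v ∈ x.correct → 4 * P.f + 3 ≤ x.count e v (.request v i) t)

/-- A run of the protocol in which at most `f` replicas are byzantine. -/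
structure IsRun : Prop where
  byz_card : x.byz.card ≤ P.f
  rotation : x.Rotation
  adjustment : x.LoadAdjustment
  change : x.EpochChange
  operation : x.Operation

/-- All correct replicas have entered epoch `e` at least `5Δ` time units ago, and none has left. -/
def Running (e t : ℕ) : Prop :=
  ∀ w ∈ x.correct, t < x.call e w ∧ ∃ a, x.enter e w = some a ∧ a + 5 * P.Δ ≤ t

open Classical in
/-- From epoch `e₀` on the system is in its stable state: GST has passed and the correct leaders work
at their capacity limit. -/
structure StableFrom (e₀ : ℕ) : Prop where
  /-- epoch-change messages of correct replicas arrive within `Δ`: a replica that sees `f + 1` of them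
  sends one too, and one that sees `2f + 1` of them starts its timer -/
  follow : ∀ e, e₀ ≤ e → ∀ u ∈ x.correct, ∀ t,
    P.f + 1 ≤ (x.correct.filter fun w => x.call e w ≤ t).card → x.call e u ≤ t + P.Δ
  start_timer : ∀ e, e₀ ≤ e → ∀ u ∈ x.correct, ∀ t,
    (∀ w ∈ x.correct, x.call e w ≤ t) → x.start (e + 1) u ≤ t + P.Δ
  /-- a correct primary initiates its epoch for all correct replicas -/
  correct_primary : ∀ e, e₀ ≤ e → x.primary (e + 1) ∈ x.correct → ∀ u ∈ x.correct,
    ∃ a, x.enter (e + 1) u = some a ∧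
      ∀ t, (∀ w ∈ x.correct, x.call e w ≤ t) → a ≤ t + P.changeTime
  /-- throughput is limited by computing power only: under a correct primary, a correct replica that
  still has requests to propose is never idle -/
  busy : ∀ e, e₀ ≤ e → x.primary (e + 1) ∈ x.correct → ∀ u ∈ x.correct, ∀ t,
    x.Running (e + 1) t → ¬ x.Delivered (e + 1) u u (x.load (e + 1) u) t →
    x.work (e + 1) u t ≠ none
  /-- under a correct primary, the no-progress timer does not expire for a correct leader that still
  has requests to commit -/
  progress : ∀ e, e₀ ≤ e → x.primary (e + 1) ∈ x.correct → ∀ u ∈ x.correct, ∀ v ∈ x.correct,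
    ∀ a t, x.enter (e + 1) u = some a → (∀ w ∈ x.correct, t ≤ x.call (e + 1) w) →
    ¬ x.Delivered (e + 1) v v (x.load (e + 1) v) t → ¬ x.NoProgress (e + 1) u v a t
  /-- under a correct primary, the load of a correct leader matches its capacity: it keeps the leader
  occupied for the epoch time `T`, up to `δ` -/
  capacity : ∀ e, e₀ ≤ e → x.primary (e + 1) ∈ x.correct → ∀ u ∈ x.correct, ∀ a t,
    x.enter (e + 1) u = some a → t + P.δ < a + P.T →
    ¬ x.Delivered (e + 1) u u (x.load (e + 1) u) t

/-- From epoch `e₀` on every replica takes part in all requests and checkpoints of all leaders,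
lagging behind by at most one checkpoint. -/
def FullParticipation (e₀ : ℕ) : Prop :=
  ∀ e, e₀ ≤ e → ∀ u v m t, x.StableCheckpoint e v (m + 1) t →
    (∀ i < P.k * m, x.Done e u (.request v i) t) ∧
      ∀ l, 1 ≤ l → l ≤ m → x.Done e u (.checkpoint v l) t

/-! ### Throughput -/

/-- Time at which the last correct replica leaves epoch `e`. -/
def leave (e : ℕ) : ℕ := x.correct.sup (x.call e)

/-- Requests committed per time unit until the end of epoch `N`. -/
noncomputable def rate (N : ℕ) : ℝ≥0∞ :=
  ((∑ e ∈ Finset.range (N + 1), x.performance e : ℕ) : ℝ≥0∞) / (x.leave N : ℝ≥0∞)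

end Run

/-- Infimum of the long-run throughput over all runs that reach the stable state, with any at most
`f` byzantine replicas behaving arbitrarily. -/
noncomputable def worstCaseThroughput (P : Params) : ℝ≥0∞ :=
  ⨅ (x : Run P) (_ : x.IsRun ∧ ∃ e₀, x.StableFrom e₀), liminf x.rate atTop

/-- Supremum of the long-run throughput over all such runs without byzantine replicas in which all
replicas take part in all requests. -/
noncomputable def bestCaseThroughput (P : Params) : ℝ≥0∞ :=
  ⨆ (x : Run P) (_ : x.IsRun ∧ x.byz = ∅ ∧ ∃ e₀, x.StableFrom e₀ ∧ x.FullParticipation e₀),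
    limsup x.rate atTop

noncomputable def effectiveUtilization (P : Params) : ℝ≥0∞ :=
  worstCaseThroughput P / bestCaseThroughput P

end FnF

namespace FnF
namespace Run

variable {P : Params} {x : Run P}

/-! ### Rotation of primaries -/

/-! Both throughputs are measured against `k * n / intervalCost`, the rate of `n` permanently busy
replicas that share all the work.

Worst case. Under a correct primary no correct replica leaves before about time `T`, and all of them
are busy almost throughout (`le_call`, `le_workload`). Watermarks confine their work to committed
requests and at most `2k` further ones per leader, so the time worked forces commits. With `m`
correct replicas the cost per request and replica decreases in `m`; at the extreme `m = 2f + 1` this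
gives a yield `l` of about `k(2f+1)T / (k(14f+8) + 6f+4)` (`le_performance`). A byzantine primary
that yields less than `l` scores below every correct one, and a list of `2f + 1` best primaries
containing it would omit a correct one. It therefore returns only by exploration, `g` epochs later,
so at most `f` of any `g` consecutive epochs fall below `l` (`card_bad_le`). Each epoch lasts at
most `T + 2Te + Δ` (`leave_succ_le`), which gives `le_liminf_rate`.

Best case. With full participation every committed request costs its full share of authenticators,
up to `3k` requests per leader and epoch, and `n` replicas supply at most `n` authenticators per
time unit (`limsup_rate_le`).

Since `T` is at least of order `n ^ 3`, all overheads are `o(T)`. The ratio of the two rates tends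
to `(38k+16)/(42k+18)` times `(g-f)/g`; for `k ≥ 1` the first factor is at least `0.9 > 8/9`. -/

theorem card_correct_add_card_byz (x : Run P) : x.correct.card + x.byz.card = 3 * P.f + 1 := by
  have := Finset.card_compl_add_card x.byz
  rwa [Fintype.card_fin] at this

theorem mem_byz_of_notMem_correct {u : Fin P.n} (h : u ∉ x.correct) : u ∈ x.byz := by
  simpa [correct] using h

theorem exists_correct_mem (hb : x.byz.card ≤ P.f) {q : List (Fin P.n)} (hq : q.Nodup)
    (hl : q.length = 2 * P.f + 1) : ∃ w ∈ x.correct, w ∈ q := by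
  by_contra! h
  have hsub : q.toFinset ⊆ x.byz := fun w hw =>
    mem_byz_of_notMem_correct fun hc => h w hc (List.mem_toFinset.1 hw)
  have := Finset.card_le_card hsub
  rw [List.toFinset_card_of_nodup hq] at this
  omega

/-- There are at least `2f + 1` correct replicas, so one slot spent on a byzantine replica leaves
too few for all of them. -/
theorem exists_correct_notMem (hb : x.byz.card ≤ P.f) {q : List (Fin P.n)} (hq : q.Nodup)
    (hl : q.length = 2 * P.f + 1) {u : Fin P.n} (hu : u ∉ x.correct) (huq : u ∈ q) :
    ∃ w ∈ x.correct, w ∉ q := by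
  by_contra! h
  have hsub : insert u x.correct ⊆ q.toFinset := by
    intro w hw
    rcases Finset.mem_insert.1 hw with rfl | hw
    · exact List.mem_toFinset.2 huq
    · exact List.mem_toFinset.2 (h w hw)
  have := Finset.card_le_card hsub
  rw [List.toFinset_card_of_nodup hq, Finset.card_insert_of_notMem hu] at this
  have := card_correct_add_card_byz x
  omega

theorem le_lastTurn {a r : ℕ} (h : a < r) : a ≤ x.lastTurn r (x.primary a) := by
  induction r with
  | zero => omega
  | succ r ih =>
    simp only [lastTurn]
    split_ifs with hr
    · omega
    · rcases Nat.lt_succ_iff_lt_or_eq.1 h with h | rfl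
      · exact ih h
      · exact absurd rfl hr

theorem primary_lastTurn {a r : ℕ} {u : Fin P.n} (ha : x.primary a = u) (h : a < r) :
    x.primary (x.lastTurn r u) = u ∧ x.lastTurn r u < r := by
  induction r with
  | zero => omega
  | succ r ih =>
    simp only [lastTurn]
    split_ifs with hr
    · exact ⟨hr, Nat.lt_succ_self r⟩
    · rcases Nat.lt_succ_iff_lt_or_eq.1 h with h | rfl
      · exact ⟨(ih h).1, (ih h).2.trans (Nat.lt_succ_self r)⟩
      · exact absurd ha hr

namespace Rotation

theorem primary_lastTurn (hr : x.Rotation) {e : ℕ} (he : P.n ≤ e) (u : Fin P.n) :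
    x.primary (x.lastTurn e u) = u ∧ x.lastTurn e u < e :=
  Run.primary_lastTurn (a := u) (Fin.ext (hr.initial u u.2)) (u.2.trans_le he)

/-- The distance to the last turn grows by one per epoch, and exploration resets it as soon as it
reaches `g`. The initial round fits because `n ≤ g`. -/
theorem le_lastTurn_add (hr : x.Rotation) (hg : P.n ≤ P.g) {e : ℕ} (he : P.n ≤ e)
    (u : Fin P.n) : e ≤ x.lastTurn e u + P.g := by
  induction e, he using Nat.le_induction with
  | base => omega
  | succ e he ih =>
    rcases ih.eq_or_lt with h | h
    · have := hr.explore e he u h.symm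
      simp only [lastTurn, this, if_true]
      have := u.pos
      omega
    · simp only [lastTurn]
      split_ifs <;> omega

/-- The queue of epoch `e` is what remains, at epoch `e`, of a list of best primaries determined at
an epoch `r ≤ e`. -/
theorem exists_isBest (hr : x.Rotation) {e : ℕ} (he : P.n ≤ e) :
    ∃ r q, P.n ≤ r ∧ r ≤ e ∧ x.IsBest r q ∧ (x.queue e).Sublist q ∧
      (∀ i, r ≤ i → i < e → x.primary i ∉ x.queue e) ∧
      ∀ u ∈ q, u ∉ x.queue e → ∃ i, r ≤ i ∧ i < e ∧ x.primary i = u := by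
  induction e, he using Nat.le_induction with
  | base =>
    exact ⟨P.n, _, le_rfl, le_rfl, hr.queue_init, List.Sublist.refl _,
      fun i h h' => by omega, fun u h h' => absurd h h'⟩
  | succ e he ih =>
    by_cases hq : (x.queue e).erase (x.primary e) = []
    · exact ⟨e + 1, _, by omega, le_rfl, hr.queue_renew e he hq, List.Sublist.refl _,
        fun i h h' => by omega, fun u h h' => absurd h h'⟩
    · obtain ⟨r, q, hnr, hre, hbest, hsub, hout, hin⟩ := ih
      have hnodup : (x.queue e).Nodup := hsub.nodup hbest.nodup
      rw [hr.queue_next e he hq]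
      refine ⟨r, q, hnr, by omega, hbest, List.erase_sublist.trans hsub, ?_, ?_⟩
      · intro i hi hie hmem
        rcases Nat.lt_succ_iff_lt_or_eq.1 hie with h | rfl
        · exact hout i hi h (List.mem_of_mem_erase hmem)
        · exact hnodup.not_mem_erase hmem
      · intro u hu hmem
        by_cases hue : u ∈ x.queue e
        · refine ⟨e, hre, Nat.lt_succ_self e, ?_⟩
          by_contra hne
          exact hmem ((List.mem_erase_of_ne (Ne.symm hne)).2 hue)
        · obtain ⟨i, h1, h2, h3⟩ := hin u hu hue
          exact ⟨i, h1, by omega, h3⟩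

/-- A primary whose last turn was less than `g` epochs ago has been elected from a list of best
primaries determined after that turn. -/
theorem exists_isBest_of_recent (hr : x.Rotation) {a e : ℕ} (he : P.n ≤ e) (hae : a < e)
    (hp : x.primary a = x.primary e) (hlt : e < a + P.g) :
    ∃ r q, P.n ≤ r ∧ a < r ∧ r ≤ e ∧ x.IsBest r q ∧ x.primary e ∈ q ∧
      ∀ c ∈ q, x.lastTurn r c < x.lastTurn r (x.primary e) →
        ∃ i, r ≤ i ∧ i < e ∧ x.primary i = c := by
  -- An exploration in epoch `e` would put the last turn of its primary exactly `g` epochs back, but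
  -- the turn at `a` is more recent.
  have hexp : ∀ u, x.lastTurn e u + P.g ≠ e := by
    intro u hu
    have h1 := hr.explore e he u hu
    have h2 := le_lastTurn (x := x) hae
    rw [hp, h1] at h2
    omega
  have hhead := hr.exploit e he hexp
  obtain ⟨r, q, hnr, hre, hbest, hsub, hout, hin⟩ := hr.exists_isBest he
  have hmem : x.primary e ∈ x.queue e := List.mem_of_mem_head? hhead
  refine ⟨r, q, hnr, ?_, hre, hbest, hsub.subset hmem, fun c hc hlast => hin c hc ?_⟩
  · by_contra! h
    exact hout a h hae (hp ▸ hmem)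
  · intro hcq
    have hpw := hbest.order.sublist hsub
    obtain ⟨l, hl⟩ := List.head?_eq_some_iff.1 hhead
    rw [hl] at hpw hcq
    rcases List.mem_cons.1 hcq with rfl | hcl
    · exact lt_irrefl _ hlast
    · exact lt_asymm hlast ((List.pairwise_cons.1 hpw).1 c hcl)

/-- Two turns of a byzantine primary are at least `g` epochs apart if it performed worse in the
first than all correct primaries. -/
theorem add_le_of_performance_lt (hr : x.Rotation) (hb : x.byz.card ≤ P.f) (hg : P.n ≤ P.g)
    {l e₁ : ℕ} (hl : ∀ e, e₁ ≤ e → x.primary e ∈ x.correct → l ≤ x.performance e)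
    {a b : ℕ} (ha : e₁ + P.n + P.g ≤ a) (hab : a < b) (hp : x.primary a = x.primary b)
    (hbad : x.performance a < l) : a + P.g ≤ b := by
  induction b using Nat.strong_induction_on with
  | _ b ih =>
    by_contra! hlt
    -- An intermediate turn already contradicts the induction hypothesis. Hence `a` and `b` are
    -- consecutive turns, and the score at `r` is the performance of epoch `a`.
    by_cases hbetween : ∃ c, a < c ∧ c < b ∧ x.primary c = x.primary b
    · obtain ⟨c, hac, hcb, hc⟩ := hbetween
      have := ih c hcb hac (hp.trans hc.symm)
      omega
    push Not at hbetween
    obtain ⟨r, q, hnr, har, hrb, hbest, hmem, -⟩ :=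
      hr.exists_isBest_of_recent (by omega) hab hp hlt
    have hu : x.primary b ∉ x.correct := fun h => by
      have := hl a (by omega) (hp ▸ h)
      omega
    obtain ⟨w, hw, hwq⟩ := exists_correct_notMem hb hbest.nodup hbest.length hu hmem
    have hscore := hbest.best _ hmem w hwq
    have h1 := le_lastTurn (x := x) har
    rw [hp] at h1
    have h2 := hr.primary_lastTurn hnr (x.primary b)
    have hlast : x.lastTurn r (x.primary b) = a := by
      by_contra hne
      exact hbetween _ (by omega) (by omega) h2.1
    -- The last turn of `w` is at most `g` epochs before `r > a`, hence late enough for the bound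
    -- `l` to apply to it.
    have h3 := hr.le_lastTurn_add hg hnr w
    have h4 := hl (x.lastTurn r w) (by omega) (by rwa [(hr.primary_lastTurn hnr w).1])
    simp only [score, hlast] at hscore
    omega

/-- In `g` consecutive epochs at most `f` perform worse than all those with a correct primary. -/
theorem card_bad_le (hr : x.Rotation) (hb : x.byz.card ≤ P.f) (hg : P.n ≤ P.g)
    {l e₁ : ℕ} (hl : ∀ e, e₁ ≤ e → x.primary e ∈ x.correct → l ≤ x.performance e)
    {a : ℕ} (ha : e₁ + P.n + P.g ≤ a) :
    ((Finset.Ico a (a + P.g)).filter fun e => x.performance e < l).card ≤ P.f := by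
  -- Bad epochs have byzantine primaries, and two of them within `g` epochs cannot share one.
  refine le_trans (Finset.card_le_card_of_injOn x.primary (t := x.byz) ?_ ?_) hb
  · intro e he
    simp only [Finset.coe_filter, Finset.mem_Ico, Set.mem_ofPred_eq] at he
    exact mem_byz_of_notMem_correct fun h => by
      have := hl e (by omega) h
      omega
  · intro b hb' c hc hbc
    simp only [Finset.coe_filter, Finset.mem_Ico, Set.mem_ofPred_eq] at hb' hc
    rcases lt_trichotomy b c with h | h | h
    · have := hr.add_le_of_performance_lt hb hg hl (by omega) h hbc hb'.2
      omega
    · exact h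
    · have := hr.add_le_of_performance_lt hb hg hl (by omega) h hbc.symm hc.2
      omega

theorem le_sum_performance_window (hr : x.Rotation) (hb : x.byz.card ≤ P.f) (hg : P.n ≤ P.g)
    {l e₁ : ℕ} (hl : ∀ e, e₁ ≤ e → x.primary e ∈ x.correct → l ≤ x.performance e)
    {a : ℕ} (ha : e₁ + P.n + P.g ≤ a) :
    (P.g - P.f) * l ≤ ∑ e ∈ Finset.Ico a (a + P.g), x.performance e := by
  have hbad := hr.card_bad_le hb hg hl ha
  have hsplit := Finset.card_filter_add_card_filter_not (s := Finset.Ico a (a + P.g))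
    (fun e => x.performance e < l)
  rw [Nat.card_Ico] at hsplit
  calc (P.g - P.f) * l
      ≤ ((Finset.Ico a (a + P.g)).filter fun e => ¬ x.performance e < l).card * l :=
        Nat.mul_le_mul_right _ (by omega)
    _ ≤ ∑ e ∈ (Finset.Ico a (a + P.g)).filter fun e => ¬ x.performance e < l,
          x.performance e := by
        rw [← smul_eq_mul]
        exact Finset.card_nsmul_le_sum _ _ _ fun e he => not_lt.1 (Finset.mem_filter.1 he).2
    _ ≤ _ := Finset.sum_le_sum_of_subset (Finset.filter_subset _ _)

theorem le_sum_performance (hr : x.Rotation) (hb : x.byz.card ≤ P.f) (hg : P.n ≤ P.g)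
    {l e₁ : ℕ} (hl : ∀ e, e₁ ≤ e → x.primary e ∈ x.correct → l ≤ x.performance e)
    {a : ℕ} (ha : e₁ + P.n + P.g ≤ a) (j : ℕ) :
    j * ((P.g - P.f) * l) ≤ ∑ e ∈ Finset.Ico a (a + j * P.g), x.performance e := by
  induction j with
  | zero => simp
  | succ j ih =>
    have h := hr.le_sum_performance_window hb hg hl (a := a + j * P.g) (by omega)
    have hs := Finset.sum_Ico_consecutive x.performance (m := a) (n := a + j * P.g)
      (k := a + j * P.g + P.g) (by omega) (by omega)
    rw [show a + (j + 1) * P.g = a + j * P.g + P.g by ring, ← hs, add_mul, one_mul]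
    exact add_le_add ih h

/-- Among `f + 1` consecutive epochs one has a correct primary. -/
theorem exists_primary_mem_correct (hr : x.Rotation) (hb : x.byz.card ≤ P.f) (hg : P.n ≤ P.g)
    {s : ℕ} (hs : P.n ≤ s) : ∃ e, s ≤ e ∧ e ≤ s + P.f ∧ x.primary e ∈ x.correct := by
  by_contra! h
  obtain ⟨a, ha, b, hb', hne, hab⟩ := Finset.exists_ne_map_eq_of_card_lt_of_maps_to
    (s := Finset.Icc s (s + P.f)) (t := x.byz) (f := x.primary)
    (by rw [Nat.card_Icc]; omega)
    (fun e he => mem_byz_of_notMem_correct (h e (Finset.mem_Icc.1 he).1 (Finset.mem_Icc.1 he).2))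
  wlog hlt : a < b generalizing a b
  · exact this b hb' a ha hne.symm hab.symm (by omega)
  rw [Finset.mem_Icc] at ha hb'
  have hn : P.n = 3 * P.f + 1 := rfl
  obtain ⟨r, q, hnr, har, hrb, hbest, hmem, hbefore⟩ :=
    hr.exists_isBest_of_recent (by omega) hlt hab (by omega)
  -- If all these epochs had byzantine primaries, the last turn of the correct `c` would precede `s
  -- ≤ a`. Then `c` stands before the repeated primary in the list and must have been elected before
  -- `b`, inside the window.
  obtain ⟨c, hc, hcq⟩ := exists_correct_mem hb hbest.nodup hbest.length
  have h1 := le_lastTurn (x := x) har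
  rw [hab] at h1
  obtain ⟨h2, h3⟩ := hr.primary_lastTurn hnr c
  obtain ⟨i, hri, hib, hi⟩ := hbefore c hcq (by
    by_contra! hle
    exact h _ (by omega) (by omega) (h2.symm ▸ hc))
  exact h i (by omega) (by omega) (hi ▸ hc)

end Rotation

/-! ### Duration of epochs -/

theorem exists_mem_correct (hb : x.byz.card ≤ P.f) : x.correct.Nonempty := by
  have := card_correct_add_card_byz x
  exact Finset.card_pos.1 (by omega)

theorem Quorum.card_ge {s : Fin P.n → Prop} [DecidablePred s] (h : x.Quorum s)
    (hb : x.byz.card ≤ P.f) : P.f + 1 ≤ (x.correct.filter s).card := by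
  unfold Quorum at h
  have : (x.correct.filter s).card = (@Finset.filter _ s (Classical.decPred s) x.correct).card := by
    congr!
  omega

theorem call_le_leave {e : ℕ} {u : Fin P.n} (hu : u ∈ x.correct) : x.call e u ≤ x.leave e :=
  Finset.le_sup (f := x.call e) hu

theorem Te_le_timer (e : ℕ) (u : Fin P.n) : P.Te ≤ x.timer e u := by
  unfold timer
  split_ifs
  · exact le_rfl
  · exact Nat.le_mul_of_pos_right _ (by positivity)

theorem timer_le {e : ℕ} {u : Fin P.n} (h : x.failures e u ≤ P.f) : x.timer e u ≤ 2 * P.Te := by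
  unfold timer
  split_ifs
  · omega
  · rw [show x.failures e u - P.f = 0 by omega]
    omega

theorem enter_eq_none_of_failures {e j : ℕ} {u : Fin P.n} (h : j ≤ x.failures e u)
    {i : ℕ} (hi : i < e) (hij : e ≤ i + j) : x.enter i u = none := by
  induction e generalizing j with
  | zero => omega
  | succ e ih =>
    simp only [failures] at h
    split_ifs at h with hn
    · rcases Nat.lt_succ_iff_lt_or_eq.1 hi with hi | rfl
      · exact ih (j := j - 1) (by omega) hi (by omega)
      · exact hn
    · omega

namespace StableFrom

variable {e₀ : ℕ}

/-- The quorum needed to start the timer contains `f + 1` correct callers, and these make every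
correct replica follow within `Δ`. -/
theorem leave_le_start (hs : x.StableFrom e₀) (hx : x.IsRun) {e : ℕ} (he : e₀ ≤ e)
    {u : Fin P.n} (hu : u ∈ x.correct) : x.leave e ≤ x.start (e + 1) u + P.Δ := by
  refine Finset.sup_le fun w hw => hs.follow e he w hw _ ?_
  exact (hx.change.start_quorum e u hu).card_ge hx.byz_card

theorem start_le (hs : x.StableFrom e₀) {e : ℕ} (he : e₀ ≤ e)
    {u : Fin P.n} (hu : u ∈ x.correct) : x.start (e + 1) u ≤ x.leave e + P.Δ :=
  hs.start_timer e he u hu _ fun _ hw => call_le_leave hw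

theorem exists_enter (hs : x.StableFrom e₀) (hx : x.IsRun) {e : ℕ} (he : e₀ ≤ e)
    (hp : x.primary (e + 1) ∈ x.correct) {u : Fin P.n} (hu : u ∈ x.correct) :
    ∃ a, x.enter (e + 1) u = some a ∧ x.leave e ≤ a + P.Δ ∧ a ≤ x.leave e + P.changeTime := by
  obtain ⟨a, ha, h⟩ := hs.correct_primary e he hp u hu
  have h1 := hs.leave_le_start hx he hu
  have h2 := hx.change.start_le_enter (e + 1) u hu a ha
  exact ⟨a, ha, by omega, h _ fun _ hw => call_le_leave hw⟩

/-- A longer streak of failures would cover an epoch with a correct primary, which every correct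
replica enters. Hence the timer is doubled at most once. -/
theorem failures_le (hs : x.StableFrom e₀) (hx : x.IsRun) (hg : P.n ≤ P.g) {e : ℕ}
    (he : e₀ + 1 + P.n + P.f + 1 ≤ e) {u : Fin P.n} (hu : u ∈ x.correct) :
    x.failures e u ≤ P.f := by
  by_contra! h
  obtain ⟨i, hi1, hi2, hi⟩ := hx.rotation.exists_primary_mem_correct hx.byz_card hg
    (s := e - (P.f + 1)) (by omega)
  have hnone := enter_eq_none_of_failures (j := P.f + 1) h (i := i) (by omega) (by omega)
  obtain ⟨i, rfl⟩ : ∃ i', i = i' + 1 := ⟨i - 1, by omega⟩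
  obtain ⟨a, ha, -⟩ := hs.correct_primary i (by omega) hi u hu
  simp [ha] at hnone

/-- An epoch takes at most the epoch time plus the doubled epoch-change timer and a message
delay. -/
theorem leave_succ_le (hs : x.StableFrom e₀) (hx : x.IsRun) (hg : P.n ≤ P.g) {e : ℕ}
    (he : e₀ + 1 + P.n + P.f + 1 ≤ e) :
    x.leave (e + 1) ≤ x.leave e + (P.T + 2 * P.Te + P.Δ) := by
  refine Finset.sup_le fun u hu => ?_
  have h1 := hs.start_le (e := e) (by omega) hu
  have h2 := timer_le (hs.failures_le hx hg (e := e + 1) (by omega) hu)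
  set t := x.start (e + 1) u + x.timer (e + 1) u with ht
  by_cases h : ∀ a, x.enter (e + 1) u = some a → t < a
  · have := hx.change.must_call (e + 1) u hu t (Or.inl ⟨h, le_rfl⟩)
    omega
  · push Not at h
    obtain ⟨a, ha, hat⟩ := h
    have := hx.change.must_call (e + 1) u hu (a + P.T)
      (Or.inr ⟨a, ha, by omega, Or.inr (Or.inl le_rfl)⟩)
    omega

/-- Under a correct primary no correct replica leaves the epoch before the correct leaders have
been occupied for the epoch time, up to `δ`. -/
theorem le_call (hs : x.StableFrom e₀) (hx : x.IsRun) (hTe : P.changeTime + P.Δ ≤ P.Te)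
    {e : ℕ} (he : e₀ ≤ e) (hp : x.primary (e + 1) ∈ x.correct) {u : Fin P.n}
    (hu : u ∈ x.correct) : x.leave e + P.T ≤ x.call (e + 1) u + P.δ + P.Δ := by
  -- It suffices to treat a first correct replica to leave, because it has a reason of its own.
  obtain ⟨m, hm, hmin⟩ := Finset.exists_min_image x.correct (x.call (e + 1)) ⟨u, hu⟩
  obtain ⟨w, hw, hwm, hreason⟩ := hx.change.own_reason (e + 1) m hm
  set t := x.call (e + 1) w with ht
  have htmin : ∀ v ∈ x.correct, t ≤ x.call (e + 1) v := fun v hv => hwm.trans (hmin v hv)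
  suffices h : x.leave e + P.T ≤ t + P.δ + P.Δ by
    have := htmin u hu
    omega
  have key : ∀ v ∈ x.correct, x.Delivered (e + 1) v v (x.load (e + 1) v) t →
      x.leave e + P.T ≤ t + P.δ + P.Δ := by
    intro v hv hd
    obtain ⟨a, ha, ha1, -⟩ := hs.exists_enter hx he hp hv
    by_contra! hlt
    exact hs.capacity e he hp v hv a t ha (by omega) hd
  obtain ⟨b, hb, hb1, hb2⟩ := hs.exists_enter hx he hp hw
  -- The epoch-change timer cannot expire before entry, as `Te ≥ changeTime + Δ`. The other reasons
  -- reduce to `key` or to the epoch timer.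
  rcases hreason with ⟨h1, h2⟩ | ⟨a, ha, hat, h | h | h⟩
  · have := h1 b hb
    have := hs.leave_le_start hx he hw
    have := Te_le_timer (x := x) (e + 1) w
    omega
  · exact key w hw (h w)
  · rw [hb] at ha
    cases ha
    omega
  -- Among `2f + 1` stalled leaders one is correct. By `progress` it must have finished its load, so
  -- `key` applies to it.
  · classical
    have hnot : ¬ (Finset.univ.filter fun v => x.NoProgress (e + 1) w v a t) ⊆ x.byz := by
      intro hsub
      have h1 := Finset.card_le_card hsub
      have h2 := hx.byz_card
      have : (Finset.univ.filter fun v => x.NoProgress (e + 1) w v a t).card =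
        (@Finset.filter _ (fun v => x.NoProgress (e + 1) w v a t)
          (fun _ => Classical.propDecidable _) Finset.univ).card := by congr!
      omega
    obtain ⟨v, hv, hvb⟩ := Finset.not_subset.1 hnot
    have hvc : v ∈ x.correct := by simpa [correct] using hvb
    refine key v hvc ?_
    by_contra hd
    exact hs.progress e he hp w hw v hvc a t ha htmin hd (Finset.mem_filter.1 hv).2

theorem le_leave_succ (hs : x.StableFrom e₀) (hx : x.IsRun) (hTe : P.changeTime + P.Δ ≤ P.Te)
    {e : ℕ} (he : e₀ ≤ e) (hp : x.primary (e + 1) ∈ x.correct) :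
    x.leave e + P.T ≤ x.leave (e + 1) + P.δ + P.Δ := by
  obtain ⟨u, hu⟩ := exists_mem_correct hx.byz_card
  have := hs.le_call hx hTe he hp hu
  have := call_le_leave (e := e + 1) hu
  omega

end StableFrom

/-! ### Work done in an epoch -/

open Classical in
/-- Number of time units before `t` that `u` spends on tasks of epoch `e`. -/
noncomputable def workload (x : Run P) (e : ℕ) (u : Fin P.n) (t : ℕ) : ℕ :=
  ((Finset.range t).filter fun s => x.work e u s ≠ none).card

/-- Under a correct primary a correct replica works for almost the whole epoch time. -/
theorem StableFrom.le_workload {e₀ : ℕ} (hs : x.StableFrom e₀) (hx : x.IsRun)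
    (hTe : P.changeTime + P.Δ ≤ P.Te) {e : ℕ} (he : e₀ ≤ e)
    (hp : x.primary (e + 1) ∈ x.correct) {u : Fin P.n} (hu : u ∈ x.correct) :
    P.T - P.δ - P.Δ - (P.changeTime + 5 * P.Δ) ≤ x.workload (e + 1) u (x.leave (e + 1)) := by
  classical
  -- From the left end on, all correct replicas have been in the epoch for `5Δ`; before the right
  -- end none has left and none has exhausted its load.
  have hsub : Finset.Ico (x.leave e + (P.changeTime + 5 * P.Δ))
      (x.leave e + (P.T - P.δ - P.Δ)) ⊆
      (Finset.range (x.leave (e + 1))).filter fun s => x.work (e + 1) u s ≠ none := by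
    intro t ht
    rw [Finset.mem_Ico] at ht
    have hcall : ∀ w ∈ x.correct, t < x.call (e + 1) w := fun w hw => by
      have := hs.le_call hx hTe he hp hw
      omega
    rw [Finset.mem_filter, Finset.mem_range]
    refine ⟨(hcall u hu).trans_le (call_le_leave hu), hs.busy e he hp u hu t ?_ ?_⟩
    · intro w hw
      obtain ⟨a, ha, -, ha2⟩ := hs.exists_enter hx he hp hw
      exact ⟨hcall w hw, a, ha, by omega⟩
    · obtain ⟨a, ha, ha1, -⟩ := hs.exists_enter hx he hp hu
      exact hs.capacity e he hp u hu a t ha (by omega)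
  have hcard := Finset.card_le_card hsub
  rw [Nat.card_Ico] at hcard
  have hw : x.workload (e + 1) u (x.leave (e + 1)) =
      ((Finset.range (x.leave (e + 1))).filter fun s => x.work (e + 1) u s ≠ none).card := by
    unfold workload
    congr!
  omega

/-- The tasks of an epoch are processed between starting its timer and leaving it. -/
theorem IsRun.add_workload_le (hx : x.IsRun) {u : Fin P.n} (hu : u ∈ x.correct) {e b : ℕ} (t : ℕ)
    (hb : b ≤ x.start e u) (hbc : b ≤ x.call e u) : b + x.workload e u t ≤ x.call e u := by
  classical
  have hsub : (Finset.range t).filter (fun s => x.work e u s ≠ none) ⊆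
      Finset.Ico b (x.call e u) := by
    intro s hs
    obtain ⟨a, ha, h1, h2⟩ := hx.operation.within_epoch e u hu s (Finset.mem_filter.1 hs).2
    have := hx.change.start_le_enter e u hu a ha
    rw [Finset.mem_Ico]
    omega
  have hcard := Finset.card_le_card hsub
  rw [Nat.card_Ico] at hcard
  have hw : x.workload e u t =
      ((Finset.range t).filter (fun s => x.work e u s ≠ none)).card := by
    unfold workload
    congr!
  omega

/-- The tasks of different epochs are processed at different times. -/
theorem IsRun.sum_workload_le (hx : x.IsRun) {u : Fin P.n} (hu : u ∈ x.correct) {a : ℕ}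
    (hmono : ∀ e, a ≤ e → x.call e u ≤ x.call (e + 1) u) {N : ℕ} (hN : a ≤ N) :
    ∑ e ∈ Finset.Ico a N, x.workload (e + 1) u (x.leave (e + 1)) ≤ x.call N u := by
  induction N, hN using Nat.le_induction with
  | base => simp
  | succ N hN ih =>
    rw [Finset.sum_Ico_succ_top hN]
    have := hx.add_workload_le hu (x.leave (N + 1)) (hx.change.call_le_start N u hu) (hmono N hN)
    omega

end Run

/-! ### Tasks -/

/-- Authenticators `u` processes for `k` requests and one checkpoint of leader `v`. -/
def Params.unitCost (P : Params) (u v : Fin P.n) : ℕ :=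
  P.k * P.cost u (.request v 0) + P.cost u (.checkpoint v 0)

theorem Params.sum_unitCost (P : Params) (v : Fin P.n) :
    ∑ u, P.unitCost u v = P.intervalCost := by
  have key : ∀ a b : ℕ, ∑ u : Fin P.n, (if u = v then a else b) = a + 3 * P.f * b := by
    intro a b
    rw [← Finset.add_sum_erase _ _ (Finset.mem_univ v), if_pos rfl,
      Finset.sum_congr rfl (fun u hu => if_neg (Finset.ne_of_mem_erase hu)), Finset.sum_const,
      Finset.card_erase_of_mem (Finset.mem_univ v), Finset.card_univ, Fintype.card_fin, smul_eq_mul]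
    rfl
  simp only [unitCost, cost, Finset.sum_add_distrib, ← Finset.mul_sum, key, intervalCost]

/-- Charging the leader cost once and a backup cost to every member of `s` covers both `v ∈ s` and a
leader outside `s`. -/
theorem Params.sum_unitCost_le (P : Params) (s : Finset (Fin P.n)) (v : Fin P.n) :
    ∑ u ∈ s, P.unitCost u v ≤
      P.k * (4 * P.f + 3 + 5 * s.card) + (2 * P.f + 2 + 2 * s.card) := by
  have key : ∀ a b : ℕ, ∑ u ∈ s, (if u = v then a else b) ≤ a + b * s.card := by
    intro a b
    calc ∑ u ∈ s, (if u = v then a else b) ≤ ∑ u ∈ s, ((if u = v then a else 0) + b) :=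
          Finset.sum_le_sum fun u _ => by split_ifs <;> omega
      _ ≤ a + b * s.card := by
          rw [Finset.sum_add_distrib, Finset.sum_ite_eq', Finset.sum_const, smul_eq_mul,
            mul_comm b]
          split_ifs <;> omega
  simp only [unitCost, cost, Finset.sum_add_distrib, ← Finset.mul_sum]
  refine add_le_add (Nat.mul_le_mul_left _ ((key _ _).trans (le_of_eq ?_)))
    ((key _ _).trans (le_of_eq ?_))
  · simp only [leaderRequestCost, backupRequestCost]; ring
  · simp only [leaderCheckpointCost, backupCheckpointCost]

/-- The task with a given index: requests are numbered from `0`, checkpoints from `1`. -/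
def taskOf {n : ℕ} : (Σ _ : Fin n, ℕ ⊕ ℕ) → Task n
  | ⟨v, .inl i⟩ => .request v i
  | ⟨v, .inr m⟩ => .checkpoint v (m + 1)

theorem taskOf_injective {n : ℕ} : Function.Injective (taskOf (n := n)) := by
  rintro ⟨v, i | i⟩ ⟨w, j | j⟩ h <;> simp_all [taskOf]

/-- Indices of the first `k * h v` requests and `h v` checkpoints of each leader `v`. -/
def tasksUpTo {n : ℕ} (k : ℕ) (h : Fin n → ℕ) : Finset (Σ _ : Fin n, ℕ ⊕ ℕ) :=
  Finset.univ.sigma fun v => (Finset.range (k * h v)).disjSum (Finset.range (h v))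

theorem sum_cost_tasksUpTo (P : Params) (u : Fin P.n) (h : Fin P.n → ℕ) :
    ∑ y ∈ tasksUpTo P.k h, P.cost u (taskOf y) = ∑ v, h v * P.unitCost u v := by
  rw [tasksUpTo, Finset.sum_sigma]
  refine Finset.sum_congr rfl fun v _ => ?_
  rw [Finset.sum_disjSum]
  simp only [taskOf, Params.cost, Params.unitCost, Finset.sum_const, Finset.card_range, smul_eq_mul]
  ring

namespace Run

variable {P : Params} {x : Run P}

/-! ### Workload as a sum of task costs -/

theorem workload_le {e t : ℕ} {u : Fin P.n} {h : Fin P.n → ℕ}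
    (hc : ∀ τ, x.count e u τ t ≤ P.cost u τ)
    (hw : ∀ s τ, x.work e u s = some τ → ∃ y ∈ tasksUpTo P.k h, taskOf y = τ) :
    x.workload e u t ≤ ∑ v, h v * P.unitCost u v := by
  classical
  rw [← sum_cost_tasksUpTo]
  calc x.workload e u t
      ≤ ((tasksUpTo P.k h).biUnion fun y =>
          (Finset.range t).filter fun s => x.work e u s = some (taskOf y)).card := by
        unfold workload
        refine Finset.card_le_card fun s hs => ?_
        obtain ⟨hst, hs⟩ := Finset.mem_filter.1 hs
        obtain ⟨τ, hτ⟩ := Option.ne_none_iff_exists'.1 hs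
        obtain ⟨y, hy, rfl⟩ := hw s τ hτ
        exact Finset.mem_biUnion.2 ⟨y, hy, Finset.mem_filter.2 ⟨hst, hτ⟩⟩
    _ ≤ _ := Finset.card_biUnion_le
    _ ≤ _ := Finset.sum_le_sum fun y _ => by
        refine le_trans (le_of_eq ?_) (hc (taskOf y))
        unfold count
        congr!

/-- A time unit serves only one task, so distinct completed tasks occupy disjoint sets of time
units. -/
theorem le_workload_of_done {e t : ℕ} {u : Fin P.n} {h : Fin P.n → ℕ}
    (hd : ∀ y ∈ tasksUpTo P.k h, x.Done e u (taskOf y) t) :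
    ∑ v, h v * P.unitCost u v ≤ x.workload e u t := by
  classical
  rw [← sum_cost_tasksUpTo]
  calc ∑ y ∈ tasksUpTo P.k h, P.cost u (taskOf y)
      ≤ ∑ y ∈ tasksUpTo P.k h,
          ((Finset.range t).filter fun s => x.work e u s = some (taskOf y)).card :=
        Finset.sum_le_sum fun y hy => (hd y hy).trans (le_of_eq (by unfold count; congr!))
    _ = ((tasksUpTo P.k h).biUnion fun y =>
          (Finset.range t).filter fun s => x.work e u s = some (taskOf y)).card := by
        refine (Finset.card_biUnion fun y _ z _ hyz => ?_).symm
        refine Finset.disjoint_filter.2 fun s _ hs hs' => hyz (taskOf_injective ?_)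
        exact Option.some_injective _ (hs.symm.trans hs')
    _ ≤ x.workload e u t := by
        unfold workload
        refine Finset.card_le_card fun s hs => ?_
        obtain ⟨y, -, hs⟩ := Finset.mem_biUnion.1 hs
        obtain ⟨hst, hs⟩ := Finset.mem_filter.1 hs
        exact Finset.mem_filter.2 ⟨hst, by simp [hs]⟩

theorem exists_work_of_count {e t : ℕ} {u : Fin P.n} {τ : Task P.n} (h : 0 < x.count e u τ t) :
    ∃ s < t, x.work e u s = some τ := by
  classical
  rw [count, Finset.card_pos] at h
  obtain ⟨s, hs⟩ := h
  rw [Finset.mem_filter, Finset.mem_range] at hs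
  exact ⟨s, hs⟩

/-- Every task done at some time has been done when the last correct replica leaves. -/
theorem IsRun.done_leave (hx : x.IsRun) {e t : ℕ} {u : Fin P.n} (hu : u ∈ x.correct)
    {τ : Task P.n} (h : x.Done e u τ t) : x.Done e u τ (x.leave e) := by
  classical
  unfold Done count at *
  refine h.trans (Finset.card_le_card fun s hs => ?_)
  rw [Finset.mem_filter] at hs ⊢
  obtain ⟨a, -, -, ha⟩ := hx.operation.within_epoch e u hu s (by simp [hs.2])
  exact ⟨Finset.mem_range.2 (ha.trans_le (call_le_leave hu)), hs.2⟩

theorem Delivered.mono {e u v i j t} (h : x.Delivered e u v j t) (hij : i ≤ j) :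
    x.Delivered e u v i t :=
  fun l hl => h l (hl.trans_le hij)

theorem cost_pos (u : Fin P.n) (τ : Task P.n) : 0 < P.cost u τ := by
  cases τ <;> simp only [Params.cost] <;> split_ifs <;>
    simp [Params.leaderRequestCost, Params.backupRequestCost, Params.leaderCheckpointCost,
      Params.backupCheckpointCost]

/-! ### Stable checkpoints -/

open Classical in
/-- The greatest stable checkpoint of leader `v` in epoch `e`. -/
noncomputable def top (x : Run P) (e : ℕ) (v : Fin P.n) : ℕ :=
  Nat.findGreatest (fun m => ∃ t, x.StableCheckpoint e v m t) (x.load e v)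

theorem IsRun.checkpoint_le (hx : x.IsRun) {e m t : ℕ} {v : Fin P.n}
    (h : x.StableCheckpoint e v m t) : P.k * m ≤ x.load e v := by
  classical
  obtain ⟨u, hu⟩ := Finset.card_pos.1 ((Nat.succ_pos _).trans_le (h.card_ge hx.byz_card))
  obtain ⟨hu, -, hcount⟩ := Finset.mem_filter.1 hu
  obtain ⟨s, -, hs⟩ := exists_work_of_count hcount
  exact (hx.operation.checkpoints e u hu s v m hs).2.1

/-- The search bound in `top` loses nothing: a stable checkpoint `m` has `k * m` at most the load,
and `k ≥ 1`. -/
theorem IsRun.le_top (hx : x.IsRun) (hk : 0 < P.k) {e m t : ℕ} {v : Fin P.n}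
    (h : x.StableCheckpoint e v m t) : m ≤ x.top e v := by
  classical
  unfold top
  refine Nat.le_findGreatest ?_ ⟨t, h⟩
  have := hx.checkpoint_le h
  nlinarith

theorem exists_stableCheckpoint_top {e : ℕ} {v : Fin P.n} (h : x.top e v ≠ 0) :
    ∃ t, x.StableCheckpoint e v (x.top e v) t := by
  classical
  exact Nat.findGreatest_of_ne_zero rfl h

theorem IsRun.low_le_top (hx : x.IsRun) (hk : 0 < P.k) {e t : ℕ} {u v : Fin P.n}
    (hu : u ∈ x.correct) : x.low e u v t ≤ x.top e v := by
  rcases Nat.eq_zero_or_pos (x.low e u v t) with h | h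
  · omega
  · obtain ⟨⟨s, -, hs⟩, -⟩ := hx.operation.low_stable e u hu v t h
    exact hx.le_top hk hs

/-- The summand `2` is the acceptance window of `2k` requests beyond a known stable checkpoint,
itself at most `top`. -/
theorem IsRun.request_lt (hx : x.IsRun) (hk : 0 < P.k) {e t i : ℕ} {u v : Fin P.n}
    (hu : u ∈ x.correct) (h : x.work e u t = some (.request v i)) :
    i < P.k * (x.top e v + 2) := by
  have h1 := (hx.operation.watermarks e u hu t v i h).2.2
  have h2 := Nat.mul_le_mul_left P.k (hx.low_le_top hk (e := e) (t := t) (v := v) hu)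
  rw [mul_add]
  omega

theorem IsRun.delivered_le (hx : x.IsRun) (hk : 0 < P.k) {e t j : ℕ} {u v : Fin P.n}
    (hu : u ∈ x.correct) (h : x.Delivered e u v j t) : j ≤ P.k * (x.top e v + 2) := by
  by_contra! hlt
  have h2 := Nat.mul_le_mul_left P.k (hx.low_le_top hk (e := e) (t := t) (v := v) hu)
  have hd := h (P.k * (x.top e v + 2)) hlt (by rw [mul_add]; omega)
  obtain ⟨s, -, hs⟩ := exists_work_of_count ((cost_pos u _).trans_le hd)
  exact lt_irrefl _ (hx.request_lt hk hu hs)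

theorem IsRun.checkpoint_mem (hx : x.IsRun) (hk : 0 < P.k) {e t m : ℕ} {u v : Fin P.n}
    (hu : u ∈ x.correct) (h : x.work e u t = some (.checkpoint v m)) :
    1 ≤ m ∧ m ≤ x.top e v + 2 := by
  obtain ⟨h1, -, h2 | h2⟩ := hx.operation.checkpoints e u hu t v m h
  · exact ⟨h1, Nat.le_of_mul_le_mul_left (hx.delivered_le hk hu h2) hk⟩
  · exact ⟨h1, (hx.le_top hk h2).trans (Nat.le_add_right _ _)⟩

theorem IsRun.workload_le (hx : x.IsRun) (hk : 0 < P.k) {e t : ℕ} {u : Fin P.n}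
    (hu : u ∈ x.correct) :
    x.workload e u t ≤ ∑ v, (x.top e v + 2) * P.unitCost u v := by
  refine Run.workload_le (fun τ => hx.operation.count_le e u hu τ t) fun s τ hs => ?_
  cases τ with
  | request v i =>
    refine ⟨⟨v, .inl i⟩, ?_, rfl⟩
    simpa [tasksUpTo] using hx.request_lt hk hu hs
  | checkpoint v m =>
    obtain ⟨h1, h2⟩ := hx.checkpoint_mem hk hu hs
    refine ⟨⟨v, .inr (m - 1)⟩, ?_, ?_⟩
    · simp only [tasksUpTo, Finset.mem_sigma, Finset.mem_univ, Finset.inr_mem_disjSum,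
        Finset.mem_range, true_and]
      omega
    · simp only [taskOf, Nat.sub_add_cancel h1]

/-- A checkpoint-certificate has `f + 1` correct signers that delivered everything below it, which
is exactly the threshold for being committed. -/
theorem IsRun.le_committed (hx : x.IsRun) (e : ℕ) (v : Fin P.n) :
    P.k * x.top e v ≤ x.committed e v := by
  classical
  rcases Nat.eq_zero_or_pos (x.top e v) with h | h
  · simp [h]
  obtain ⟨t, ht⟩ := exists_stableCheckpoint_top h.ne'
  have hload := hx.checkpoint_le ht
  unfold committed
  conv_lhs => rw [← Finset.card_range (P.k * x.top e v)]
  refine Finset.card_le_card fun i hi => ?_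
  rw [Finset.mem_range] at hi
  refine Finset.mem_filter.2 ⟨Finset.mem_range.2 (hi.trans_le hload), ?_⟩
  refine (ht.card_ge hx.byz_card).trans (Finset.card_le_card fun u hu => ?_)
  obtain ⟨hu, hd, -⟩ := Finset.mem_filter.1 hu
  exact Finset.mem_filter.2 ⟨hu, t, hd.mono hi⟩

theorem IsRun.committed_le (hx : x.IsRun) (hk : 0 < P.k) (e : ℕ) (v : Fin P.n) :
    x.committed e v ≤ P.k * (x.top e v + 2) := by
  classical
  unfold committed
  rw [← Finset.card_range (P.k * (x.top e v + 2))]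
  refine Finset.card_le_card fun i hi => ?_
  obtain ⟨u, hu⟩ := Finset.card_pos.1 ((Nat.succ_pos _).trans_le (Finset.mem_filter.1 hi).2)
  obtain ⟨hu, t, hd⟩ := Finset.mem_filter.1 hu
  exact Finset.mem_range.2 (hx.delivered_le hk hu hd)

/-- Committed requests under a correct primary, in terms of the time the correct replicas work. -/
theorem IsRun.sum_workload_le_performance (hx : x.IsRun) (hk : 0 < P.k) (e t : ℕ) :
    P.k * ∑ u ∈ x.correct, x.workload e u t ≤
      (x.performance e + 2 * P.k * P.n) *
        (P.k * (4 * P.f + 3 + 5 * x.correct.card) + (2 * P.f + 2 + 2 * x.correct.card)) := by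
  set K := P.k * (4 * P.f + 3 + 5 * x.correct.card) + (2 * P.f + 2 + 2 * x.correct.card)
  calc P.k * ∑ u ∈ x.correct, x.workload e u t
      ≤ P.k * ∑ u ∈ x.correct, ∑ v, (x.top e v + 2) * P.unitCost u v :=
        Nat.mul_le_mul_left _ (Finset.sum_le_sum fun u hu => hx.workload_le hk hu)
    _ = P.k * ∑ v, (x.top e v + 2) * ∑ u ∈ x.correct, P.unitCost u v := by
        rw [Finset.sum_comm]
        simp only [Finset.mul_sum]
    _ ≤ P.k * ∑ v, (x.top e v + 2) * K := Nat.mul_le_mul_left _ (Finset.sum_le_sum fun v _ =>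
        Nat.mul_le_mul_left _ (P.sum_unitCost_le _ v))
    _ = (∑ v, (P.k * x.top e v + 2 * P.k)) * K := by
        rw [← Finset.sum_mul, ← mul_assoc, Finset.mul_sum]
        congr 1
        exact Finset.sum_congr rfl fun v _ => by ring
    _ ≤ _ := by
        refine Nat.mul_le_mul_right _ ?_
        rw [Finset.sum_add_distrib, Finset.sum_const, Finset.card_univ, Fintype.card_fin,
          smul_eq_mul, mul_comm P.n]
        exact Nat.add_le_add_right (Finset.sum_le_sum fun v _ => hx.le_committed e v) _

/-- If all replicas take part in all requests, the work needed for the committed requests. -/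
theorem IsRun.performance_mul_le (hx : x.IsRun) (hk : 0 < P.k) (hbyz : x.byz = ∅) {e₀ : ℕ}
    (hfull : x.FullParticipation e₀) {e : ℕ} (he : e₀ ≤ e) :
    x.performance e * P.intervalCost ≤
      P.k * ∑ u, x.workload e u (x.leave e) + 3 * P.k * P.n * P.intervalCost := by
  have hcorrect : ∀ u, u ∈ x.correct := fun u => by simp [correct, hbyz]
  -- Full participation guarantees work only up to the checkpoint before `top`. Together with the
  -- `2` in `committed_le`, this accounts for the `3k` requests per leader.
  have hwork : ∀ u, ∑ v, (x.top e v - 1) * P.unitCost u v ≤ x.workload e u (x.leave e) := by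
    intro u
    refine le_workload_of_done ?_
    rintro ⟨v, y⟩ hy
    rw [tasksUpTo, Finset.mem_sigma] at hy
    have hpos : x.top e v ≠ 0 := by
      intro h
      simp [h] at hy
    obtain ⟨t, ht⟩ := exists_stableCheckpoint_top hpos
    rw [show x.top e v = x.top e v - 1 + 1 by omega] at ht
    obtain ⟨h1, h2⟩ := hfull e he u v _ t ht
    refine hx.done_leave (hcorrect u) (t := t) ?_
    rcases y with i | m
    · exact h1 i (by simpa using hy.2)
    · have hm : m < x.top e v - 1 := by simpa using hy.2
      exact h2 (m + 1) (by omega) (by omega)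
  calc x.performance e * P.intervalCost
      ≤ (∑ v, (P.k * (x.top e v - 1) + 3 * P.k)) * P.intervalCost := by
        refine Nat.mul_le_mul_right _ (Finset.sum_le_sum fun v _ => ?_)
        refine (hx.committed_le hk e v).trans ?_
        calc P.k * (x.top e v + 2) ≤ P.k * (x.top e v - 1 + 3) :=
              Nat.mul_le_mul_left _ (by omega)
          _ = _ := by ring
    _ = P.k * ∑ v, (x.top e v - 1) * P.intervalCost + 3 * P.k * P.n * P.intervalCost := by
        rw [Finset.sum_add_distrib, Finset.sum_const, Finset.card_univ, Fintype.card_fin,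
          smul_eq_mul, add_mul, ← Finset.mul_sum, ← Finset.sum_mul]
        ring
    _ = P.k * ∑ u, ∑ v, (x.top e v - 1) * P.unitCost u v + 3 * P.k * P.n * P.intervalCost := by
        rw [Finset.sum_comm]
        simp only [← Finset.mul_sum, P.sum_unitCost]
    _ ≤ _ := Nat.add_le_add_right
        (Nat.mul_le_mul_left _ (Finset.sum_le_sum fun u _ => hwork u)) _

end Run

/-! ### Bounds on the throughput -/

namespace Run

variable {P : Params} {x : Run P}

/-- Requests committed in an epoch with a correct primary. -/
theorem StableFrom.le_performance {e₀ : ℕ} (hs : x.StableFrom e₀) (hx : x.IsRun) (hk : 0 < P.k)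
    (hTe : P.changeTime + P.Δ ≤ P.Te) {e : ℕ} (he : e₀ ≤ e)
    (hp : x.primary (e + 1) ∈ x.correct) :
    P.k * (2 * P.f + 1) * (P.T - P.δ - P.Δ - (P.changeTime + 5 * P.Δ)) ≤
      (x.performance (e + 1) + 2 * P.k * P.n) * (P.k * (14 * P.f + 8) + (6 * P.f + 4)) := by
  set B := P.T - P.δ - P.Δ - (P.changeTime + 5 * P.Δ)
  set m := x.correct.card with hm
  have hcard := card_correct_add_card_byz x
  have hbyz := hx.byz_card
  have hmf : 2 * P.f + 1 ≤ m := by omega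
  have h1 := hx.sum_workload_le_performance hk (e + 1) (x.leave (e + 1))
  have h2 : m * B ≤ ∑ u ∈ x.correct, x.workload (e + 1) u (x.leave (e + 1)) := by
    rw [← smul_eq_mul]
    exact Finset.card_nsmul_le_sum _ _ _ fun u hu => hs.le_workload hx hTe he hp hu
  rw [← hm] at h1
  set R := x.performance (e + 1) + 2 * P.k * P.n
  -- The cost is affine in `m` with nonnegative constant term, so cost divided by `m` is largest at
  -- `m = 2f + 1`, where it involves `14f + 8` and `6f + 4`.
  have h3 : (P.k * (4 * P.f + 3 + 5 * m) + (2 * P.f + 2 + 2 * m)) * (2 * P.f + 1) ≤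
      m * (P.k * (14 * P.f + 8) + (6 * P.f + 4)) := by
    have := Nat.mul_le_mul_left (P.k * (4 * P.f + 3) + (2 * P.f + 2)) hmf
    nlinarith
  refine le_of_mul_le_mul_left (a := m) ?_ (by omega)
  calc m * (P.k * (2 * P.f + 1) * B) = P.k * (m * B) * (2 * P.f + 1) := by ring
    _ ≤ R * (P.k * (4 * P.f + 3 + 5 * m) + (2 * P.f + 2 + 2 * m)) * (2 * P.f + 1) :=
        Nat.mul_le_mul_right _ ((Nat.mul_le_mul_left _ h2).trans h1)
    _ = R * ((P.k * (4 * P.f + 3 + 5 * m) + (2 * P.f + 2 + 2 * m)) * (2 * P.f + 1)) := by ring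
    _ ≤ R * (m * (P.k * (14 * P.f + 8) + (6 * P.f + 4))) := Nat.mul_le_mul_left _ h3
    _ = _ := by ring

theorem StableFrom.leave_add_le {e₀ : ℕ} (hs : x.StableFrom e₀) (hx : x.IsRun) (hg : P.n ≤ P.g)
    {a : ℕ} (ha : e₀ + 1 + P.n + P.f + 1 ≤ a) (m : ℕ) :
    x.leave (a + m) ≤ x.leave a + m * (P.T + 2 * P.Te + P.Δ) := by
  induction m with
  | zero => simp
  | succ m ih =>
    have := hs.leave_succ_le hx hg (e := a + m) (by omega)
    rw [← add_assoc, add_mul, one_mul]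
    omega

/-- If `l` requests are committed in each epoch with a correct primary, the throughput is at least
the fraction `(g - f) / g` of `l` per maximal duration of an epoch. -/
theorem StableFrom.le_liminf_rate {e₀ : ℕ} (hs : x.StableFrom e₀) (hx : x.IsRun)
    (hg : P.n ≤ P.g) {l : ℕ}
    (hl : ∀ e, e₀ ≤ e → x.primary (e + 1) ∈ x.correct → l ≤ x.performance (e + 1))
    {W : ℝ} (hW : 0 ≤ W)
    (hWl : W * (P.g * (P.T + 2 * P.Te + P.Δ)) < ((P.g : ℝ) - P.f) * l) :
    ENNReal.ofReal W ≤ liminf x.rate atTop := by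
  have hn : P.n = 3 * P.f + 1 := rfl
  set D := P.T + 2 * P.Te + P.Δ with hD
  have hDr : (P.T + 2 * P.Te + P.Δ : ℝ) = D := by push_cast [hD]; ring
  rw [hDr] at hWl
  set a := e₀ + 1 + P.n + P.g + P.f + 1 with ha
  have hgf : ((P.g - P.f : ℕ) : ℝ) = (P.g : ℝ) - P.f := Nat.cast_sub (by omega)
  set c := ((P.g : ℝ) - P.f) * l with hc
  have hgpos : (0 : ℝ) < P.g := by
    have : 0 < P.g := by omega
    exact_mod_cast this
  have hcpos : 0 < c := lt_of_le_of_lt (by positivity) hWl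
  -- After `M` epochs the linear surplus `c - W * (g * D)` outweighs the time before epoch `a` and
  -- one incomplete window of `g` epochs.
  obtain ⟨M, hM⟩ := exists_nat_ge ((P.g * W * x.leave a + P.g * c) / (c - W * (P.g * D)))
  rw [div_le_iff₀ (by linarith)] at hM
  refine le_liminf_of_le (by isBoundedDefault) (eventually_atTop.2 ⟨a + (M + P.g), fun N hN => ?_⟩)
  obtain ⟨m, rfl⟩ := Nat.exists_eq_add_of_le (show a ≤ N by omega)
  have hmM : M + P.g ≤ m := by omega
  have hsum : ((m / P.g : ℕ) : ℝ) * c ≤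
      ((∑ e ∈ Finset.range (a + m + 1), x.performance e : ℕ) : ℝ) := by
    have h1 := hx.rotation.le_sum_performance hx.byz_card hg (l := l) (e₁ := e₀ + 1)
      (fun e he hp => by
        obtain ⟨e, rfl⟩ : ∃ e', e = e' + 1 := ⟨e - 1, by omega⟩
        exact hl e (by omega) hp) (a := a) (by omega) (m / P.g)
    have h2 : ∑ e ∈ Finset.Ico a (a + m / P.g * P.g), x.performance e ≤
        ∑ e ∈ Finset.range (a + m + 1), x.performance e := by
      refine Finset.sum_le_sum_of_subset fun e he => ?_
      have := Nat.div_mul_le_self m P.g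
      rw [Finset.mem_Ico] at he
      rw [Finset.mem_range]
      omega
    rw [hc, ← hgf]
    exact_mod_cast h1.trans h2
  have hdiv : (m : ℝ) ≤ P.g * (m / P.g : ℕ) + P.g := by
    have := Nat.lt_mul_div_succ m (show 0 < P.g by omega)
    rw [mul_add, mul_one] at this
    exact_mod_cast this.le
  have hdiv_pos : (0 : ℝ) < (m / P.g : ℕ) := by
    exact_mod_cast Nat.div_pos (show P.g ≤ m by omega) (by omega)
  have hleave : (x.leave (a + m) : ℝ) ≤ x.leave a + m * D := by
    exact_mod_cast hs.leave_add_le hx hg (a := a) (by omega) m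
  have hmM' : (M : ℝ) ≤ m := by
    have : M ≤ m := by omega
    exact_mod_cast this
  have hmain : W * x.leave (a + m) ≤
      ((∑ e ∈ Finset.range (a + m + 1), x.performance e : ℕ) : ℝ) := by
    refine le_trans ?_ hsum
    refine le_of_mul_le_mul_left (a := (P.g : ℝ)) ?_ hgpos
    have h1 := mul_le_mul_of_nonneg_left hleave (mul_nonneg hgpos.le hW)
    have h2 := mul_le_mul_of_nonneg_right hdiv hcpos.le
    have h3 := mul_le_mul_of_nonneg_right hmM' (sub_nonneg.2 hWl.le)
    linarith
  have hsum_pos := (mul_pos hdiv_pos hcpos).trans_le hsum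
  unfold rate
  rw [ENNReal.le_div_iff_mul_le (Or.inr ?_) (Or.inl (ENNReal.natCast_ne_top _)),
    ← ENNReal.ofReal_natCast, ← ENNReal.ofReal_mul hW, ← ENNReal.ofReal_natCast]
  · exact ENNReal.ofReal_le_ofReal hmain
  · exact_mod_cast hsum_pos.ne'

/-- The computing power of the replicas and the work per request bound the throughput. -/
theorem StableFrom.limsup_rate_le {e₀ : ℕ} (hs : x.StableFrom e₀) (hx : x.IsRun) (hk : 0 < P.k)
    (hTe : P.changeTime + P.Δ ≤ P.Te) (hbyz : x.byz = ∅) (hfull : x.FullParticipation e₀)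
    {B : ℕ} (hB : 0 < B) (hBT : B + P.δ + P.Δ ≤ P.T) {U : ℝ}
    (hU : (P.k * P.n * B + 3 * P.k * P.n * P.intervalCost : ℝ) < U * (P.intervalCost * B)) :
    limsup x.rate atTop ≤ ENNReal.ofReal U := by
  have hcorrect : ∀ u, u ∈ x.correct := fun u => by simp [correct, hbyz]
  have hstep : ∀ e, e₀ ≤ e → x.leave e + B ≤ x.leave (e + 1) := fun e he => by
    have := hs.le_leave_succ hx hTe he (hcorrect _)
    omega
  -- Epochs last at least `B`, so the additive overhead per epoch can be charged to elapsed time.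
  have hleave : ∀ m, m * B ≤ x.leave (e₀ + m) := by
    intro m
    induction m with
    | zero => simp
    | succ m ih =>
      have := hstep (e₀ + m) (by omega)
      rw [← add_assoc, add_mul, one_mul]
      omega
  have hwork : ∀ m, ∑ e ∈ Finset.Ico e₀ (e₀ + m), ∑ u, x.workload (e + 1) u (x.leave (e + 1)) ≤
      P.n * x.leave (e₀ + m) := by
    intro m
    rw [Finset.sum_comm]
    calc _ ≤ ∑ _u : Fin P.n, x.leave (e₀ + m) := Finset.sum_le_sum fun u _ => by
          refine (hx.sum_workload_le (hcorrect u) (fun e he => ?_) (by omega)).trans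
            (call_le_leave (hcorrect u))
          have := hs.le_call hx hTe he (hcorrect _) (hcorrect u)
          have := call_le_leave (e := e) (hcorrect u)
          omega
      _ = _ := by simp
  have hperf : ∀ m, (∑ e ∈ Finset.Ico e₀ (e₀ + m), x.performance (e + 1)) * P.intervalCost ≤
      P.k * (P.n * x.leave (e₀ + m)) + m * (3 * P.k * P.n * P.intervalCost) := by
    intro m
    rw [Finset.sum_mul]
    calc _ ≤ ∑ e ∈ Finset.Ico e₀ (e₀ + m),
          (P.k * ∑ u, x.workload (e + 1) u (x.leave (e + 1)) +
            3 * P.k * P.n * P.intervalCost) := Finset.sum_le_sum fun e he =>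
          hx.performance_mul_le hk hbyz hfull (by rw [Finset.mem_Ico] at he; omega)
      _ = P.k * ∑ e ∈ Finset.Ico e₀ (e₀ + m), ∑ u, x.workload (e + 1) u (x.leave (e + 1)) +
            m * (3 * P.k * P.n * P.intervalCost) := by
          rw [Finset.sum_add_distrib, ← Finset.mul_sum, Finset.sum_const, Nat.card_Ico,
            smul_eq_mul, Nat.add_sub_cancel_left]
      _ ≤ _ := Nat.add_le_add_right (Nat.mul_le_mul_left _ (hwork m)) _
  set C := ∑ e ∈ Finset.range (e₀ + 1), x.performance e with hC
  have hsum : ∀ m, ∑ e ∈ Finset.range (e₀ + m + 1), x.performance e =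
      C + ∑ e ∈ Finset.Ico e₀ (e₀ + m), x.performance (e + 1) := by
    intro m
    induction m with
    | zero => simp [hC]
    | succ m ih =>
      rw [Finset.sum_range_succ, ← add_assoc, ih, Finset.sum_Ico_succ_top (by omega), add_assoc]
  have hBr : (0 : ℝ) < B := by exact_mod_cast hB
  have hI : (0 : ℝ) < P.intervalCost := by
    have : 0 < P.intervalCost := by
      simp only [Params.intervalCost, Params.leaderCheckpointCost]
      omega
    exact_mod_cast this
  set Y : ℝ := P.k * P.n * B + 3 * P.k * P.n * P.intervalCost with hY
  -- `M` is chosen so that the strict slack in `hU` absorbs the requests `C` committed up to epoch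
  -- `e₀`.
  obtain ⟨M, hM⟩ := exists_nat_ge (P.intervalCost * B * C / (U * (P.intervalCost * B) - Y))
  rw [div_le_iff₀ (by linarith)] at hM
  refine limsup_le_of_le (by isBoundedDefault) (eventually_atTop.2 ⟨e₀ + M, fun N hN => ?_⟩)
  obtain ⟨m, rfl⟩ := Nat.exists_eq_add_of_le (show e₀ ≤ N by omega)
  have hUpos : 0 ≤ U := by
    by_contra! h
    have : U * (P.intervalCost * B) < 0 := mul_neg_of_neg_of_pos h (mul_pos hI hBr)
    have : 0 ≤ Y := by positivity
    linarith
  unfold rate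
  refine ENNReal.div_le_of_le_mul ?_
  rw [← ENNReal.ofReal_natCast, ← ENNReal.ofReal_natCast, ← ENNReal.ofReal_mul hUpos]
  refine ENNReal.ofReal_le_ofReal ?_
  rw [hsum m]
  set S := ∑ e ∈ Finset.Ico e₀ (e₀ + m), x.performance (e + 1)
  have h1 : (S * P.intervalCost : ℝ) ≤ P.k * (P.n * x.leave (e₀ + m)) +
      m * (3 * P.k * P.n * P.intervalCost) := by exact_mod_cast hperf m
  have h2 : (m * B : ℝ) ≤ x.leave (e₀ + m) := by exact_mod_cast hleave m
  have h3 : (M : ℝ) ≤ x.leave (e₀ + m) := by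
    have : M ≤ m * B := (show M ≤ m by omega).trans (Nat.le_mul_of_pos_right _ hB)
    exact_mod_cast this.trans (hleave m)
  set t : ℝ := (x.leave (e₀ + m) : ℝ)
  refine le_of_mul_le_mul_left (a := (P.intervalCost * B : ℝ)) ?_ (mul_pos hI hBr)
  have h4 := mul_le_mul_of_nonneg_right h1 hBr.le
  have h5 := mul_le_mul_of_nonneg_left h2
    (show (0 : ℝ) ≤ 3 * P.k * P.n * P.intervalCost by positivity)
  have h6 := mul_le_mul_of_nonneg_right h3 (sub_nonneg.2 hU.le)
  push_cast
  rw [hY] at h6 hM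
  linarith

end Run

theorem le_worstCaseThroughput {P : Params} (hk : 0 < P.k) (hg : P.n ≤ P.g)
    (hTe : P.changeTime + P.Δ ≤ P.Te) {W : ℝ} (hW : 0 ≤ W) {l : ℕ}
    (hl : (l + 2 * P.k * P.n) * (P.k * (14 * P.f + 8) + (6 * P.f + 4)) ≤
      P.k * (2 * P.f + 1) * (P.T - P.δ - P.Δ - (P.changeTime + 5 * P.Δ)))
    (hWl : W * (P.g * (P.T + 2 * P.Te + P.Δ)) < ((P.g : ℝ) - P.f) * l) :
    ENNReal.ofReal W ≤ worstCaseThroughput P := by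
  refine le_iInf₂ fun x hx => ?_
  obtain ⟨hx, e₀, hs⟩ := hx
  refine hs.le_liminf_rate hx hg (fun e he hp => ?_) hW hWl
  have := Nat.le_of_mul_le_mul_right (hl.trans (hs.le_performance hx hk hTe he hp)) (by positivity)
  omega

theorem bestCaseThroughput_le {P : Params} (hk : 0 < P.k) (hTe : P.changeTime + P.Δ ≤ P.Te)
    {B : ℕ} (hB : 0 < B) (hBT : B + P.δ + P.Δ ≤ P.T) {U : ℝ}
    (hU : (P.k * P.n * B + 3 * P.k * P.n * P.intervalCost : ℝ) < U * (P.intervalCost * B)) :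
    bestCaseThroughput P ≤ ENNReal.ofReal U := by
  refine iSup₂_le fun x hx => ?_
  obtain ⟨hx, hbyz, e₀, hs, hfull⟩ := hx
  exact hs.limsup_rate_le hx hk hTe hbyz hfull hB hBT hU

/-! ### Numerical comparison of the two throughput bounds -/

theorem Params.intervalCost_eq (P : Params) :
    P.intervalCost = P.k * (19 * P.f + 3) + (8 * P.f + 2) := by
  simp only [intervalCost, leaderRequestCost, backupRequestCost, leaderCheckpointCost,
    backupCheckpointCost]
  ring

/-- Byzantine replicas reduce the computing power per request by at most the factor `0.895`. -/
theorem computing_power_ratio {f k : ℝ} (hf : 1000 ≤ f) (hk : 1 ≤ k) :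
    0.895 * ((3 * f + 1) * (k * (14 * f + 8) + (6 * f + 4))) ≤
      (2 * f + 1) * (k * (19 * f + 3) + (8 * f + 2)) := by
  -- This is the coefficient of `k` in the difference of the two sides, with `0.41 = 38 - 0.895 *
  -- 42`. Being nonnegative, it reduces the claim to `k = 1`.
  have h1 : 0 ≤ 0.41 * f ^ 2 - 9.01 * f - 4.16 := by nlinarith
  have h2 := mul_le_mul_of_nonneg_right hk h1
  nlinarith

/-- With `c = k * n / intervalCost`, the best case is at most `1.001 * c`, and the worst case at
least `1.001 * c` times the claimed ratio. The gap between `0.895` and `8/9` pays for all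
tolerances. -/
theorem le_effectiveUtilization {P : Params} (hk : 0 < P.k) (hg : P.n ≤ P.g)
    (hTe : P.changeTime + P.Δ ≤ P.Te) (hf : 1000 ≤ P.f) (hT : 0 < P.T)
    (hδT : (P.δ : ℝ) ≤ P.T / 10000) (hTeT : (P.Te : ℝ) ≤ P.T / 10000)
    (hIT : (P.intervalCost : ℝ) ≤ P.T / 100000) :
    ENNReal.ofReal (8 / 9 * (((P.g : ℝ) - P.f) / P.g)) ≤ effectiveUtilization P := by
  have hn : P.n = 3 * P.f + 1 := rfl
  have hTr : (0 : ℝ) < P.T := by exact_mod_cast hT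
  have hkr : (1 : ℝ) ≤ P.k := by exact_mod_cast hk
  have hfr : (1000 : ℝ) ≤ P.f := by exact_mod_cast hf
  have hnr : (P.n : ℝ) = 3 * P.f + 1 := by rw [hn]; push_cast; ring
  have hIr : (P.intervalCost : ℝ) = P.k * (19 * P.f + 3) + (8 * P.f + 2) := by
    rw [P.intervalCost_eq]; push_cast; ring
  have hIpos : (0 : ℝ) < P.intervalCost := by rw [hIr]; positivity
  have hgn : (3 * P.f + 1 : ℝ) ≤ P.g := by
    rw [← hnr]
    exact_mod_cast hg
  have hgpos : (0 : ℝ) < P.g := by linarith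
  have hgf : (0 : ℝ) < (P.g : ℝ) - P.f := by linarith
  have hnpos : (1 : ℝ) ≤ P.n := by rw [hnr]; linarith
  have hkn : (1 : ℝ) ≤ P.k * P.n := by nlinarith
  -- The start-up losses of an epoch are all charged to `2 * Te`.
  have hTe2 : P.changeTime + 6 * P.Δ ≤ 2 * P.Te := by
    have : 5 * P.Δ ≤ P.changeTime := by simp only [Params.changeTime]; omega
    omega
  have hΔ : (P.Δ : ℝ) ≤ P.Te := by
    have : P.Δ ≤ P.Te := by omega
    exact_mod_cast this
  set c : ℝ := P.k * P.n / P.intervalCost with hc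
  have hcpos : 0 < c := by positivity
  have hcI : c * P.intervalCost = P.k * P.n := by rw [hc]; field_simp
  have hW : ENNReal.ofReal (1.001 * c * (8 / 9 * (((P.g : ℝ) - P.f) / P.g))) ≤
      worstCaseThroughput P := by
    set B := P.T - P.δ - P.Δ - (P.changeTime + 5 * P.Δ) with hB
    set K := P.k * (14 * P.f + 8) + (6 * P.f + 4) with hK
    have hKpos : 0 < K := by positivity
    have hKr : (K : ℝ) = P.k * (14 * P.f + 8) + (6 * P.f + 4) := by rw [hK]; push_cast; ring
    have hKrpos : (0 : ℝ) < K := by exact_mod_cast hKpos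
    have hBr : (P.T : ℝ) - P.δ - 2 * P.Te ≤ B := by
      have : P.T ≤ B + P.δ + 2 * P.Te := by omega
      have : (P.T : ℝ) ≤ B + P.δ + 2 * P.Te := by exact_mod_cast this
      linarith
    set q := P.k * (2 * P.f + 1) * B / K with hq
    have hqr : (P.k * (2 * P.f + 1) * B : ℝ) < K * (q + 1) := by
      exact_mod_cast Nat.lt_mul_div_succ (P.k * (2 * P.f + 1) * B) hKpos
    have hratio : 0.895 * c * K ≤ P.k * (2 * P.f + 1) := by
      have h := computing_power_ratio hfr hkr
      rw [← hnr, ← hKr, ← hIr] at h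
      refine le_of_mul_le_mul_right (a := (P.intervalCost : ℝ)) ?_ hIpos
      have h' := mul_le_mul_of_nonneg_left h (show (0 : ℝ) ≤ P.k by positivity)
      calc 0.895 * c * K * P.intervalCost = 0.895 * (c * P.intervalCost) * K := by ring
        _ = P.k * (0.895 * (P.n * K)) := by rw [hcI]; ring
        _ ≤ _ := h'
        _ = _ := by ring
    have hq1 : 0.895 * c * (0.9997 * P.T) ≤ q + 1 := by
      have hB' : 0.9997 * (P.T : ℝ) ≤ B := by linarith
      refine le_of_mul_le_mul_left (a := (K : ℝ)) ?_ hKrpos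
      calc (K : ℝ) * (0.895 * c * (0.9997 * P.T)) = 0.895 * c * K * (0.9997 * P.T) := by ring
        _ ≤ P.k * (2 * P.f + 1) * B := by gcongr
        _ ≤ _ := hqr.le
    -- `2kn` covers the possibly uncommitted windows; the remaining `kn ≥ 1` covers the rounding in
    -- `q`.
    have hlow : (3 * P.k * P.n : ℝ) ≤ 0.00003 * (c * P.T) := by
      have := mul_le_mul_of_nonneg_left hIT hcpos.le
      rw [hcI] at this
      linarith
    have hcT : 0 < c * P.T := by positivity
    have hq2 : 2 * P.k * P.n ≤ q := by
      have : (2 * P.k * P.n : ℝ) ≤ q := by linarith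
      exact_mod_cast this
    refine le_worstCaseThroughput hk hg hTe (by positivity) (l := q - 2 * P.k * P.n) ?_ ?_
    · rw [Nat.sub_add_cancel hq2]
      exact Nat.div_mul_le_self _ _
    · rw [Nat.cast_sub hq2]
      push_cast
      have hD : (P.T + 2 * P.Te + P.Δ : ℝ) ≤ 1.0003 * P.T := by linarith
      calc 1.001 * c * (8 / 9 * (((P.g : ℝ) - P.f) / P.g)) * (P.g * (P.T + 2 * P.Te + P.Δ))
          = ((P.g : ℝ) - P.f) * (1.001 * c * (8 / 9) * (P.T + 2 * P.Te + P.Δ)) := by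
            field_simp
        _ ≤ ((P.g : ℝ) - P.f) * (1.001 * c * (8 / 9) * (1.0003 * P.T)) := by gcongr
        _ < _ := by
            refine mul_lt_mul_of_pos_left ?_ hgf
            linarith
  have hU : bestCaseThroughput P ≤ ENNReal.ofReal (1.001 * c) := by
    have hB : P.δ + P.Δ ≤ P.T := by
      have : (P.δ + P.Δ : ℝ) ≤ P.T := by linarith
      exact_mod_cast this
    have hBr : ((P.T - (P.δ + P.Δ) : ℕ) : ℝ) = P.T - (P.δ + P.Δ) := by
      rw [Nat.cast_sub hB]; push_cast; ring
    have hBpos : (0 : ℝ) < ((P.T - (P.δ + P.Δ) : ℕ) : ℝ) := by rw [hBr]; linarith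
    refine bestCaseThroughput_le hk hTe (B := P.T - (P.δ + P.Δ)) (by exact_mod_cast hBpos)
      (by omega) ?_
    set B : ℝ := ((P.T - (P.δ + P.Δ) : ℕ) : ℝ)
    calc (P.k * P.n * B + 3 * P.k * P.n * P.intervalCost : ℝ)
        = P.k * P.n * (B + 3 * P.intervalCost) := by ring
      _ < P.k * P.n * (1.001 * B) := mul_lt_mul_of_pos_left (by linarith) (by linarith)
      _ = 1.001 * c * (P.intervalCost * B) := by rw [← hcI]; ring
  calc ENNReal.ofReal (8 / 9 * (((P.g : ℝ) - P.f) / P.g))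
      = ENNReal.ofReal (1.001 * c * (8 / 9 * (((P.g : ℝ) - P.f) / P.g))) /
          ENNReal.ofReal (1.001 * c) := by
        rw [← ENNReal.ofReal_div_of_pos (by positivity)]
        congr 1
        field_simp
    _ ≤ _ := ENNReal.div_le_div hW hU

end FnF

theorem mainTheorem8 (k Δ : ℕ) (hk : 0 < k) (g Cmin T Te Tp δ : ℕ → ℕ)
    (P : ℕ → FnF.Params)
    (hP : ∀ f, P f = ⟨f, k, Δ, g f, Cmin f, T f, Te f, Tp f, δ f⟩)
    (hg : ∀ f, (P f).n ≤ g f)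
    (hCmin : (fun f : ℕ => ((P f).n : ℝ) ^ 2) =O[atTop] fun f => (Cmin f : ℝ))
    (hT : ∀ f, Cmin f * (P f).intervalCost ≤ k * T f)
    (hTe : ∀ f, (P f).changeTime + Δ ≤ Te f)
    (hTe_quadratic : (fun f => (Te f : ℝ)) =O[atTop] fun f : ℕ => ((P f).n : ℝ) ^ 2)
    (hδ : (fun f => (δ f : ℝ)) =o[atTop] fun f => (T f : ℝ)) :
    (∀ᶠ f in atTop, ENNReal.ofReal (8 / 9 * (((g f : ℝ) - f) / g f))
        ≤ FnF.effectiveUtilization (P f)) ∧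
      ∀ f : ℕ, (16 / 27 : ℝ) < 8 / 9 * (((g f : ℝ) - f) / g f) := by
  have hn : ∀ f, (P f).n = 3 * f + 1 := fun f => by rw [hP f]; rfl
  have hnr : ∀ f, ((P f).n : ℝ) = 3 * f + 1 := fun f => by rw [hn f]; push_cast; ring
  have hgr : ∀ f : ℕ, (3 * f + 1 : ℝ) ≤ g f := fun f => by
    rw [← hnr f]
    exact_mod_cast hg f
  refine ⟨?_, fun f => ?_⟩
  · have hI : ∀ f, ((P f).intervalCost : ℝ) = k * (19 * f + 3) + (8 * f + 2) := fun f => by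
      rw [FnF.Params.intervalCost_eq, hP f]
      push_cast
      ring
    obtain ⟨c₁, hc₁, h₁⟩ := hCmin.exists_pos
    obtain ⟨c₂, hc₂, h₂⟩ := hTe_quadratic.exists_pos
    have hlarge : Tendsto (fun f : ℕ => (f : ℝ)) atTop atTop := tendsto_natCast_atTop_atTop
    filter_upwards [h₁.bound, h₂.bound, hδ.bound (show (0 : ℝ) < 1 / 10000 by norm_num),
      eventually_ge_atTop 1000, hlarge.eventually_ge_atTop (10000 * (c₁ * c₂ * k)),
      hlarge.eventually_ge_atTop (100000 * (c₁ * k))] with f h₁ h₂ h₃ hf hf₁ hf₂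
    simp only [norm_pow, Real.norm_natCast] at h₁ h₂ h₃
    have hfr : (1000 : ℝ) ≤ f := by exact_mod_cast hf
    have hkr : (1 : ℝ) ≤ k := by exact_mod_cast hk
    have hTr : (Cmin f * (P f).intervalCost : ℝ) ≤ k * T f := by exact_mod_cast hT f
    have hIf : (f : ℝ) ≤ (P f).intervalCost := by
      rw [hI f]
      nlinarith
    have hIpos : (0 : ℝ) < (P f).intervalCost := by linarith
    have hn1 : (f : ℝ) ≤ ((P f).n : ℝ) ^ 2 := by
      rw [hnr f]
      nlinarith
    -- As `intervalCost` is at least `f`, the epoch time is of order at least `n ^ 3` and dominates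
    -- both `Te`, of order `n ^ 2`, and `intervalCost`.
    have hnT : ((P f).n : ℝ) ^ 2 * (P f).intervalCost ≤ c₁ * k * T f := by
      calc ((P f).n : ℝ) ^ 2 * (P f).intervalCost
          ≤ c₁ * Cmin f * (P f).intervalCost := by gcongr
        _ = c₁ * (Cmin f * (P f).intervalCost) := by ring
        _ ≤ c₁ * (k * T f) := by gcongr
        _ = _ := by ring
    have hTpos : (0 : ℝ) < T f := by
      have : (0 : ℝ) < c₁ * k * T f := lt_of_lt_of_le (mul_pos (by linarith) hIpos) hnT
      exact pos_of_mul_pos_right this (by positivity)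
    have hTeT : (Te f : ℝ) ≤ T f / 10000 := by
      have h : (10000 * (c₁ * c₂ * k)) * Te f ≤ (c₁ * c₂ * k) * T f := by
        calc (10000 * (c₁ * c₂ * k)) * Te f ≤ (P f).intervalCost * (c₂ * ((P f).n : ℝ) ^ 2) := by
              gcongr
              exact hf₁.trans hIf
          _ = c₂ * (((P f).n : ℝ) ^ 2 * (P f).intervalCost) := by ring
          _ ≤ c₂ * (c₁ * k * T f) := by gcongr
          _ = _ := by ring
      have := le_of_mul_le_mul_left (a := c₁ * c₂ * k) (b := 10000 * (Te f : ℝ)) (c := T f)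
        (by linarith) (by positivity)
      linarith
    have hIT : ((P f).intervalCost : ℝ) ≤ T f / 100000 := by
      have h : (100000 * (c₁ * k)) * (P f).intervalCost ≤ (c₁ * k) * T f :=
        (mul_le_mul_of_nonneg_right (hf₂.trans hn1) hIpos.le).trans hnT
      have := le_of_mul_le_mul_left (a := c₁ * k) (b := 100000 * ((P f).intervalCost : ℝ))
        (c := T f) (by linarith) (by positivity)
      linarith
    have hPf : (P f).f = f ∧ (P f).k = k ∧ (P f).Δ = Δ ∧ (P f).g = g f ∧ (P f).T = T f ∧
        (P f).Te = Te f ∧ (P f).δ = δ f := by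
      rw [hP f]
      exact ⟨rfl, rfl, rfl, rfl, rfl, rfl, rfl⟩
    obtain ⟨e₁, e₂, e₃, e₄, e₅, e₆, e₇⟩ := hPf
    have hδT : (δ f : ℝ) ≤ T f / 10000 := by linarith
    have key := FnF.le_effectiveUtilization (P := P f)
    rw [e₁, e₂, e₃, e₄, e₅, e₆, e₇] at key
    exact key hk (hg f) (hTe f) hf (by exact_mod_cast hTpos) hδT hTeT hIT
  · have h := hgr f
    have hf : (0 : ℝ) ≤ f := Nat.cast_nonneg f
    have hpos : (0 : ℝ) < g f := by linarith
    -- Equivalent to `g > 3f`; and `8/9 * 2/3 = 16/27`.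
    have : (2 / 3 : ℝ) < ((g f : ℝ) - f) / g f := by
      rw [lt_div_iff₀ hpos]
      linarith
    linarith
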